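/- **Setting.** Time is slotted, $t=1,\dots,T$. An instance $\mathcal I$ consists of a horizon $T$, an initial age $A_0\in\mathbb N$, age increments $\Delta A(t)\in\mathbb N$, update costs $C(t)$ with $0<C_m\le C(t)\le C_M$, and update opportunities $U(t)\in\{0,1\}$ (slot $t$ is ON if $U(t)=1$, OFF if $U(t)=0$). A schedule $d(t)\in\{0,1\}$ must satisfy $d(t)\le U(t)$; the age satisfies $A(0)=A_0$, $A(t)=0$ if $d(t)=1$ and $A(t)=A(t-1)+\Delta A(t)$ if $d(t)=0$. $\mathrm{OPT}(\mathcal I)$ is the minimum of $\sum_{t=1}^T (C(t)d(t)+A(t))$ over all such schedules. The age is viewed as a queue of virtual packets: $A_0$ packets are present at the start of slot $1$ and $\Delta A(t)$ packets arrive at the start of slot $t$; packets are numbered in order of arrival and $T_i$ is the arrival slot of packet $i$ ($T_i=1$ for the initial packets). For variables $x(t),z_i(t)\ge 0$ the LP objective is $\sum_{t=1}^T\big(C(t)x(t)+\sum_{i:T_i\le t}z_i(t)\big)$. **Algorithm.** Given $C_m,C_M$, put $\theta=(1+\frac1{C_M})^{C_m}-1$, initialize all $x(t),z_i(t)$ to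 $0$ and $\hat t$ to $1$. In slot $t=1,\dots,T$: if $t>1$ and $U(t-1)=1$, set $\hat t\leftarrow t$. Then for each packet $i$ with $T_i\le t$, in order of arrival: if $\sum_{\tau=T_i}^t x(\tau)<1$, set $z_i(t)\leftarrow 1-\sum_{\tau=T_i}^t x(\tau)$ and, if moreover $U(t)=1$, perform the step "if $\sum_{\tau=T_i}^{t}x(\tau)<1$ then $x(t)\leftarrow x(t)+\frac1{C_M}\sum_{\tau=T_i}^{t}x(\tau)+\frac1{\theta C_M}$" $t-\hat t+1$ times if $T_i<\hat t$, and once if $T_i\ge\hat t$. Let $\Delta A_M=\max\{A_0,\Delta A(1),\dots,\Delta A(T)\}$, and let $T_{\mathrm{OFF}}$ be the maximum number of consecutive OFF slots up to and including the next ON slot (or up to slot $T$ if no ON slot follows), i.e. the maximal length of a window of slots in $\{1,\dots,T\}$ all of whose slots but possibly the last are OFF. **Theorem.** (i) For every instance $\mathcal I$, the LP objective value computed by the algorithm at the end of slot $T$ is at most $$\left[\left(1+\tfrac1{C_m}\right)^{1+2\lceil\sqrt{\Delta A_M C_m}\rceil T_{\mathrm{OFF}}}\left(1+\frac1{(1+\frac1{C_M})^{C_m}-1}\right)+\frac{2\lceil\sqrt{\Delta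 A_M C_m}\rceil T_{\mathrm{OFF}}}{C_m}\right]\mathrm{OPT}(\mathcal I).$$ (ii) Let $C(t)=C_u\mathcal E(t)$ with $\mathcal E_m\le\mathcal E(t)\le\mathcal E_M$, where $0<\mathcal E_m\le\mathcal E_M$ are fixed, let $C_m=C_u\mathcal E_m$, $C_M=C_u\mathcal E_M$ and $R=\mathcal E_M/\mathcal E_m$. For all fixed finite values of $\Delta A_M$ and $T_{\mathrm{OFF}}$ the factor in brackets tends to $\frac{e^{1/R}}{e^{1/R}-1}$ as $C_u\to\infty$. Moreover, for all fixed integers $a,L\ge1$, the competitive ratio of the algorithm over all instances of this form with $\Delta A_M\le a$ and $T_{\mathrm{OFF}}\le L$ (the least $\gamma$ such that the objective value computed is at most $\gamma\,\mathrm{OPT}(\mathcal I)$ for all these instances) exists for every $C_u>0$ and tends to $\frac{e^{1/R}}{e^{1/R}-1}$ as $C_u\to\infty$. -/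

import Mathlib

namespace AgeUpdate

/-- An uncertainty instance: horizon `T`, initial age `A₀`, integer age increments `ΔA(t)`,
update costs `C(t)` and update opportunities `U(t)` (`true` is ON, `false` is OFF).
Slots are `1, …, T`; the values outside this range are never used. -/
structure Instance where
  T : ℕ
  initialAge : ℕ
  increment : ℕ → ℕ
  cost : ℕ → ℝ
  on : ℕ → Bool

namespace Instance

/-! ### The age model and the offline optimum -/

/-- The ON slots of the horizon. -/
def onSlots (I : Instance) : Finset ℕ := (Finset.Icc 1 I.T).filter fun t => I.on t = true

/-- The age `A(t)` at the end of slot `t` when updates are sent exactly in the slots of `D`. -/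
def age (I : Instance) (D : Finset ℕ) : ℕ → ℕ
  | 0 => I.initialAge
  | t + 1 => if t + 1 ∈ D then 0 else I.age D t + I.increment (t + 1)

/-- The total cost of the schedule `D`: update costs plus age costs. -/
noncomputable def totalCost (I : Instance) (D : Finset ℕ) : ℝ :=
  ∑ t ∈ Finset.Icc 1 I.T, ((if t ∈ D then I.cost t else 0) + (I.age D t : ℝ))

/-- The offline optimum: the least total cost of a schedule that updates only in ON slots. -/
noncomputable def opt (I : Instance) : ℝ :=
  I.onSlots.powerset.inf' ⟨∅, Finset.empty_mem_powerset _⟩ I.totalCost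

/-! ### Virtual packets -/

/-- The number of virtual packets that have arrived by slot `t ≥ 1`. The packets are
`0, 1, 2, …` in the order of arrival, so that packet `i` has arrived by slot `t` iff
`i < I.arrived t`. -/
def arrived (I : Instance) (t : ℕ) : ℕ :=
  I.initialAge + ∑ s ∈ Finset.Icc 1 t, I.increment s

/-- The arrival slot `T_i` of virtual packet `i`: the first slot `t ≥ 1` at which it is in the
queue (the initially queued packets have `T_i = 1`). -/
noncomputable def arrivalSlot (I : Instance) (i : ℕ) : ℕ :=
  sInf {t : ℕ | 1 ≤ t ∧ i < I.arrived t}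

/-- The objective of the linear program at `x(t)`, `z_i(t)`. -/
noncomputable def lpObjective (I : Instance) (x : ℕ → ℝ) (z : ℕ → ℕ → ℝ) : ℝ :=
  ∑ t ∈ Finset.Icc 1 I.T, (I.cost t * x t + ∑ i ∈ Finset.range (I.arrived t), z i t)

/-- `ΔA_M`: the maximal increment, the initial packets counting as one batch. -/
def maxIncrement (I : Instance) : ℕ :=
  max I.initialAge ((Finset.Icc 1 I.T).sup I.increment)

/-- `T_OFF`: the maximal length of a window of slots `s, …, t` in which all slots before `t`
are OFF, i.e. of a run of consecutive OFF slots up to and including the next ON slot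
(or up to the end of the horizon if no ON slot follows). -/
def maxOff (I : Instance) : ℕ :=
  ((Finset.Icc 1 I.T ×ˢ Finset.Icc 1 I.T).filter fun p =>
    p.1 ≤ p.2 ∧ ∀ s ∈ Finset.Ico p.1 p.2, I.on s = false).sup fun p => p.2 + 1 - p.1

end Instance

/-! ### The online algorithm -/

/-- `θ = (1 + 1/C_M)^{C_m} - 1`. -/
noncomputable def theta (Cm CM : ℝ) : ℝ := (1 + 1 / CM) ^ Cm - 1

/-- The variables of the algorithm: `x(t)`, `z_i(t)` (as `z i t`) and the pointer `t̂`. -/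
structure State where
  x : ℕ → ℝ
  z : ℕ → ℕ → ℝ
  ptr : ℕ

/-- `∑_{τ = Ti}^{t} x(τ)`. -/
noncomputable def cumulative (x : ℕ → ℝ) (Ti t : ℕ) : ℝ := ∑ τ ∈ Finset.Icc Ti t, x τ

/-- One conditional increment of `x(t)` on behalf of a packet with arrival slot `Ti`. -/
noncomputable def activate (Cm CM : ℝ) (Ti t : ℕ) (x : ℕ → ℝ) : ℕ → ℝ :=
  if cumulative x Ti t < 1 then
    Function.update x t (x t + 1 / CM * cumulative x Ti t + 1 / (theta Cm CM * CM))
  else x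

/-- The body of the loop over packets: the adjustments made in slot `t` for packet `i`.
The body of the inner loop `t' = t, …, t̂` does not depend on `t'`, so the loop is an iteration
of `t + 1 - t̂` conditional increments. -/
noncomputable def packetStep (I : Instance) (Cm CM : ℝ) (t : ℕ) (σ : State) (i : ℕ) : State :=
  let Ti := I.arrivalSlot i
  if cumulative σ.x Ti t < 1 then
    { x := if I.on t = true then
              (if Ti < σ.ptr then (activate Cm CM Ti t)^[t + 1 - σ.ptr] σ.x
               else activate Cm CM Ti t σ.x)
            else σ.x
      z := Function.update σ.z i (Function.update (σ.z i) t (1 - cumulative σ.x Ti t))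
      ptr := σ.ptr }
  else σ

/-- Slot `t`: adjust the pointer, then treat all arrived packets in the order of arrival. -/
noncomputable def slotStep (I : Instance) (Cm CM : ℝ) (t : ℕ) (σ : State) : State :=
  (List.range (I.arrived t)).foldl (packetStep I Cm CM t)
    { σ with ptr := if 1 < t ∧ I.on (t - 1) = true then t else σ.ptr }

/-- The state of the algorithm at the end of slot `t`. -/
noncomputable def run (I : Instance) (Cm CM : ℝ) : ℕ → State
  | 0 => { x := fun _ => 0, z := fun _ _ => 0, ptr := 1 }
  | t + 1 => slotStep I Cm CM (t + 1) (run I Cm CM t)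

/-- The objective value computed by the algorithm at the end of slot `T`. -/
noncomputable def algValue (I : Instance) (Cm CM : ℝ) : ℝ :=
  I.lpObjective (run I Cm CM I.T).x (run I Cm CM I.T).z

/-! ### Competitive ratios -/

/-- The factor of the bound, for maximal increment `a` and maximal OFF window `L`. -/
noncomputable def ratioBound (a L : ℕ) (Cm CM : ℝ) : ℝ :=
  (1 + 1 / Cm) ^ (1 + 2 * ⌈Real.sqrt (a * Cm)⌉₊ * L) * (1 + 1 / ((1 + 1 / CM) ^ Cm - 1))
    + 2 * (⌈Real.sqrt (a * Cm)⌉₊ : ℝ) * L / Cm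

/-- The instances with costs `C(t) = C_u E(t)`, `E_m ≤ E(t) ≤ E_M`, with `ΔA_M ≤ a` and
`T_OFF ≤ L`. -/
def scaledInstances (a L : ℕ) (Em EM Cu : ℝ) : Set Instance :=
  {I | I.maxIncrement ≤ a ∧ I.maxOff ≤ L ∧ ∃ E : ℕ → ℝ,
    ∀ t ∈ Finset.Icc 1 I.T, Em ≤ E t ∧ E t ≤ EM ∧ I.cost t = Cu * E t}

/-- The factors `γ` for which the algorithm, run with `C_m`, `C_M`, is `γ`-competitive
on the class `𝓘` of instances. -/
def competitiveFactors (𝓘 : Set Instance) (Cm CM : ℝ) : Set ℝ :=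
  {γ | ∀ I ∈ 𝓘, algValue I Cm CM ≤ γ * I.opt}

end AgeUpdate

/-!
The upper bound is a primal-dual argument on the virtual packets. Whenever `x(t)` is increased for
a packet with cumulative sum `u`, the quantity `u + 1/θ` is multiplied by `q = 1 + 1/C_M`, and the
increase costs at most `u + 1/θ`; a packet is no longer served once `u ≥ 1`, that is once
`q ^ k ≥ 1 + θ = q ^ C_m`. Giving each effective increment the dual weight `1`, the packets present
at an ON slot `τ` carry a total weight of at most `C_m + 1` from `τ` on (`Packed`,
`sum_fires_le`). So an update in slot `τ` of any schedule pays for the weight it covers up to the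
factor `1 + 1/C_m`. The uncovered weight, together with the waiting in OFF slots that no schedule
can avoid, is at most the age cost of the schedule (`sum_uncovered_le_waiting`).

A unit of weight is to pay for `1 + 1/θ`, namely `u + 1/θ` for the increment and `1 - u` for
waiting. A packet that arrived before the current window (a run of OFF slots and the next ON slot)
has its increments withheld until the end of the window, when its cumulative sum may have grown in
the meantime. The resulting deficit in a window of length `ℓ` is at most `ℓ` times the growth of the
truncated cumulative sum (`window_cost_le`), so over all windows it telescopes to at most `T_OFF`
per packet (`sum_packetCost_le`, `sum_excess_le_min`), and it vanishes for packets that do not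
survive their first window. To treat a final run of OFF slots in the same way, the analysis follows
a virtual run of the algorithm in which the last slot always ends a window.

With `K = ⌈√(ΔA_M C_m)⌉`, the truncated growth that causes deficits, at most `1` per packet, sums to
at most `4 K / C_m` times the cost of any schedule (`sum_excess_le`); this mostly amounts to counting
packets. If `C_m ≤ K`, a packet with a deficit either waits or arrives in the slot
of an update, where at most `C_m + 1` packets survive. If `K < C_m`, then with `h = ⌈C_m / K⌉` each
packet is an initial one, waits in at least `h` slots, or arrives in the last `h` slots before an
update or the end of the horizon (`arrived_le_of_waiting`). A schedule without updates cannot pay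
for the packets near the end of the horizon; there the deficit is small because few increments were
made (`excess_le_of_no_update`). Bernoulli's inequality turns the sum of the two estimates into the
bracket of the bound.

For the limit of the competitive ratio, a single initial packet, `⌈C_m⌉` ON slots and update costs
`C_M` force the ratio `1 + 1/θ` (`le_of_mem_competitiveFactors`), which has the same limit as the
upper bound.
-/

namespace AgeUpdate

/-! ### Iterated conditional increments -/

/-- One conditional increment, as it acts on the cumulative sum `u` of the packet it serves. -/
noncomputable def bump (θ CM u : ℝ) : ℝ :=
  if u < 1 then u + 1 / CM * u + 1 / (θ * CM) else u

/-- The number of effective increments among `n` conditional increments started at `u`. -/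
noncomputable def bumpCount (θ CM u : ℝ) : ℕ → ℕ
  | 0 => 0
  | n + 1 => bumpCount θ CM u n + if (bump θ CM)^[n] u < 1 then 1 else 0

section bump

variable {θ CM : ℝ}

/-- Each effective increment multiplies `u + 1/θ` by `1 + 1/C_M`. -/
lemma bump_add_inv (hC : 0 < CM) (hθ : 0 < θ) {u : ℝ} (hu : u < 1) :
    bump θ CM u + 1 / θ = (u + 1 / θ) * (1 + 1 / CM) := by
  rw [bump, if_pos hu]
  field_simp
  ring

lemma bump_of_one_le {u : ℝ} (hu : 1 ≤ u) : bump θ CM u = u := by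
  rw [bump, if_neg (not_lt.2 hu)]

lemma le_bump (hC : 0 < CM) (hθ : 0 < θ) {u : ℝ} (hu : 0 ≤ u) : u ≤ bump θ CM u := by
  rw [bump]
  split_ifs
  · have : 0 ≤ 1 / CM * u := by positivity
    have : 0 ≤ 1 / (θ * CM) := by positivity
    linarith
  · exact le_rfl

lemma le_iterate_bump (hC : 0 < CM) (hθ : 0 < θ) {u : ℝ} (hu : 0 ≤ u) (n : ℕ) :
    u ≤ (bump θ CM)^[n] u := by
  induction n with
  | zero => exact le_rfl
  | succ n ih =>
    rw [Function.iterate_succ_apply']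
    exact ih.trans (le_bump hC hθ (hu.trans ih))

lemma iterate_bump_of_one_le {u : ℝ} (hu : 1 ≤ u) (n : ℕ) : (bump θ CM)^[n] u = u :=
  Function.iterate_fixed (bump_of_one_le hu) n

lemma bumpCount_of_one_le {u : ℝ} (hu : 1 ≤ u) (n : ℕ) : bumpCount θ CM u n = 0 := by
  induction n with
  | zero => rfl
  | succ n ih => simp [bumpCount, ih, iterate_bump_of_one_le hu, hu]

lemma iterate_bump_add_inv (hC : 0 < CM) (hθ : 0 < θ) (u : ℝ) (n : ℕ) :
    (bump θ CM)^[n] u + 1 / θ = (u + 1 / θ) * (1 + 1 / CM) ^ bumpCount θ CM u n := by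
  induction n with
  | zero => simp [bumpCount]
  | succ n ih =>
    rw [Function.iterate_succ_apply', bumpCount]
    split_ifs with h
    · rw [bump_add_inv hC hθ h, ih, pow_succ]; ring
    · rw [bump_of_one_le (not_lt.1 h), ih, add_zero]

/-- Before the last effective increment the cumulative sum is still less than `1`. -/
lemma bumpCount_pred_lt (hC : 0 < CM) (hθ : 0 < θ) (u : ℝ) (n : ℕ)
    (h : 0 < bumpCount θ CM u n) :
    (u + 1 / θ) * (1 + 1 / CM) ^ (bumpCount θ CM u n - 1) < 1 + 1 / θ := by
  induction n with
  | zero => simp [bumpCount] at h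
  | succ n ih =>
    rw [bumpCount] at h ⊢
    split_ifs at h ⊢ with h1
    · rw [Nat.add_sub_cancel, ← iterate_bump_add_inv hC hθ]
      linarith
    · exact ih h

lemma mul_iterate_bump_sub_le (hC : 0 < CM) (hθ : 0 < θ) {u : ℝ} (hu : 0 ≤ u) (n : ℕ) :
    CM * ((bump θ CM)^[n] u - u)
      ≤ bumpCount θ CM u n * (min 1 ((bump θ CM)^[n] u) + 1 / θ) := by
  induction n with
  | zero => simp [bumpCount]
  | succ n ih =>
    have h0 : 0 ≤ (bump θ CM)^[n] u := hu.trans (le_iterate_bump hC hθ hu n)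
    have hle := le_bump hC hθ h0
    rw [Function.iterate_succ_apply', bumpCount]
    set w := (bump θ CM)^[n] u with hw
    split_ifs with h
    · have e : CM * (bump θ CM w - w) = w + 1 / θ := by
        rw [bump, if_pos h]; field_simp; ring
      have h1 : w ≤ min 1 (bump θ CM w) := le_min h.le hle
      have h2 : min 1 w ≤ min 1 (bump θ CM w) := min_le_min le_rfl hle
      have h3 : (bumpCount θ CM u n : ℝ) * (min 1 w + 1 / θ)
          ≤ bumpCount θ CM u n * (min 1 (bump θ CM w) + 1 / θ) := by gcongr
      push_cast
      nlinarith
    · rw [bump_of_one_le (not_lt.1 h), add_zero]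
      exact ih

lemma bumpCount_le (u : ℝ) (n : ℕ) : bumpCount θ CM u n ≤ n := by
  induction n with
  | zero => exact le_rfl
  | succ n ih => rw [bumpCount]; split_ifs <;> omega

/-- If some of the `n` conditional increments has no effect, the cumulative sum has reached `1`. -/
lemma one_le_iterate_bump_of_bumpCount_lt (u : ℝ) (n : ℕ) (h : bumpCount θ CM u n < n) :
    1 ≤ (bump θ CM)^[n] u := by
  induction n with
  | zero => simp at h
  | succ n ih =>
    rw [Function.iterate_succ_apply']
    by_cases h1 : (bump θ CM)^[n] u < 1
    · rw [bumpCount, if_pos h1] at h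
      exact absurd (ih (by omega)) (not_le.2 h1)
    · rw [bump_of_one_le (not_lt.1 h1)]
      exact not_lt.1 h1

lemma one_le_bumpCount {u : ℝ} (hu : u < 1) {n : ℕ} (hn : 0 < n) :
    1 ≤ bumpCount θ CM u n := by
  induction n with
  | zero => omega
  | succ n ih =>
    rcases Nat.eq_zero_or_pos n with rfl | h
    · simp [bumpCount, hu]
    · rw [bumpCount]; have := ih h; omega

/-- The cost of a packet in the last slot of a window of `ℓ` slots that starts after the arrival
of the packet, together with its unpaid waiting cost in that window: `g` is the cumulative sum
before the slot, `u` the one when the packet is processed, `s` the one after the slot. -/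
lemma window_cost_le (hC : 0 < CM) (hθ : 0 < θ) {g u s : ℝ} (hg : 0 ≤ g) (hgu : g ≤ u)
    (ℓ : ℕ) (hs : (bump θ CM)^[ℓ] u ≤ s) :
    ℓ * (1 - min 1 g) + CM * ((bump θ CM)^[ℓ] u - u)
      ≤ (1 + 1 / θ) * bumpCount θ CM u ℓ + ℓ * (min 1 s - min 1 g) := by
  have h1 := mul_iterate_bump_sub_le hC hθ (hg.trans hgu) ℓ
  have h2 : min 1 ((bump θ CM)^[ℓ] u) ≤ min 1 s := min_le_min le_rfl hs
  have hM : min 1 s ≤ 1 := min_le_left _ _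
  set r := bumpCount θ CM u ℓ with hr
  have hr0 : (0 : ℝ) ≤ r := Nat.cast_nonneg _
  have h3 : (r : ℝ) * (min 1 ((bump θ CM)^[ℓ] u) + 1 / θ) ≤ r * (min 1 s + 1 / θ) := by gcongr
  rcases (bumpCount_le (θ := θ) (CM := CM) u ℓ).lt_or_eq with h | h
  · have h4 := one_le_iterate_bump_of_bumpCount_lt u ℓ h
    have h5 : min 1 s = 1 := min_eq_left (h4.trans hs)
    rw [h5] at h3 ⊢
    linarith
  · have : (r : ℝ) = ℓ := by rw [hr, h]
    rw [this] at h1 h3 ⊢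
    linarith

/-- A packet that arrived in the current window pays at most `1 + 1/θ` in an ON slot if it is
active, and nothing otherwise. -/
lemma fresh_cost_le (hC : 0 < CM) (hθ : 0 < θ) (u : ℝ) :
    max 0 (1 - u) + CM * ((bump θ CM)^[1] u - u) ≤ (1 + 1 / θ) * bumpCount θ CM u 1 := by
  by_cases h : u < 1
  · have e : CM * (bump θ CM u - u) = u + 1 / θ := by
      rw [bump, if_pos h]; field_simp; ring
    have h1 : max 0 (1 - u) = 1 - u := max_eq_right (by linarith)
    simp only [Function.iterate_one, h1, e, bumpCount, Function.iterate_zero, id]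
    simp only [h, if_true]
    push_cast
    linarith
  · have h' := not_lt.1 h
    rw [iterate_bump_of_one_le h', bumpCount_of_one_le h', max_eq_left (by linarith)]
    simp

end bump

lemma theta_pos {Cm CM : ℝ} (hm : 0 < Cm) (hM : 0 < CM) : 0 < theta Cm CM := by
  have : 0 < 1 / CM := by positivity
  have := Real.one_lt_rpow (x := 1 + 1 / CM) (by linarith) hm
  rw [theta]; linarith

/-- The invariant of the packing argument. If every one of `N` effective increments is made at a
level at least `w`, where `w` is the total of the increments made so far, then `w` has grown to at
least `(q ^ N - 1) / θ` with `q = 1 + 1/C_M`, so that fewer than `C_m + 1` increments fit. -/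
structure Packed (Cm CM : ℝ) (N : ℕ) (w : ℝ) : Prop where
  nonneg : 0 ≤ w
  growth : 1 / theta Cm CM * (1 + 1 / CM) ^ N ≤ w + 1 / theta Cm CM
  card_le : (N : ℝ) ≤ Cm + 1

lemma Packed.mono {Cm CM : ℝ} {N : ℕ} {w w' : ℝ} (h : Packed Cm CM N w) (hw : w ≤ w') :
    Packed Cm CM N w' :=
  ⟨h.nonneg.trans hw, h.growth.trans (by linarith), h.card_le⟩

lemma packed_zero {Cm CM : ℝ} (hm : 0 < Cm) : Packed Cm CM 0 0 :=
  ⟨le_rfl, by simp, by simp; linarith⟩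

lemma Packed.add {Cm CM : ℝ} (hm : 0 < Cm) (hM : 0 < CM) {N : ℕ} {w u : ℝ}
    (h : Packed Cm CM N w) (hu : w ≤ u) (n : ℕ) :
    Packed Cm CM (N + bumpCount (theta Cm CM) CM u n)
      (w + ((bump (theta Cm CM) CM)^[n] u - u)) := by
  have hθ := theta_pos hm hM
  have hu0 : 0 ≤ u := h.nonneg.trans hu
  have hle := le_iterate_bump hM hθ hu0 n
  have e := iterate_bump_add_inv hM hθ u n
  have hlt := bumpCount_pred_lt hM hθ u n
  set θ := theta Cm CM with hθdef
  set r := bumpCount θ CM u n with hr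
  have hq : 1 < 1 + 1 / CM := by have : 0 < 1 / CM := by positivity
                                 linarith
  have hqr : 1 ≤ (1 + 1 / CM) ^ r := one_le_pow₀ hq.le
  refine ⟨by linarith [h.nonneg], ?_, ?_⟩
  · have h1 : (w + 1 / θ) * (1 + 1 / CM) ^ r - (w + 1 / θ)
        ≤ (u + 1 / θ) * (1 + 1 / CM) ^ r - (u + 1 / θ) := by nlinarith
    have h2 : 1 / θ * (1 + 1 / CM) ^ (N + r) ≤ (w + 1 / θ) * (1 + 1 / CM) ^ r := by
      rw [pow_add, ← mul_assoc]
      exact mul_le_mul_of_nonneg_right h.growth (by positivity)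
    linarith
  · rcases Nat.eq_zero_or_pos r with h0 | hpos
    · rw [h0, add_zero]; exact h.card_le
    · have h1 : 1 / θ * (1 + 1 / CM) ^ (N + (r - 1)) < 1 / θ * (1 + 1 / CM) ^ Cm := by
        calc 1 / θ * (1 + 1 / CM) ^ (N + (r - 1))
            ≤ (u + 1 / θ) * (1 + 1 / CM) ^ (r - 1) := by
              rw [pow_add, ← mul_assoc]
              exact mul_le_mul_of_nonneg_right (h.growth.trans (by linarith)) (by positivity)
          _ < 1 + 1 / θ := hlt hpos
          _ = 1 / θ * (1 + 1 / CM) ^ Cm := by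
              have : (1 + 1 / CM) ^ Cm = θ + 1 := by rw [hθdef, theta]; ring
              rw [this]; field_simp
      have h2 := lt_of_mul_lt_mul_left h1 (by positivity)
      rw [← Real.rpow_natCast, Real.rpow_lt_rpow_left_iff hq] at h2
      have h3 : ((r - 1 : ℕ) : ℝ) = r - 1 := by rw [Nat.cast_sub hpos]; simp
      push_cast [h3] at h2 ⊢
      linarith


/-! ### Arrivals and windows -/

namespace Instance

lemma arrived_mono (I : Instance) : Monotone I.arrived := fun s t h => by
  unfold arrived
  gcongr

lemma arrived_succ (I : Instance) (t : ℕ) :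
    I.arrived (t + 1) = I.arrived t + I.increment (t + 1) := by
  rw [arrived, arrived, Finset.sum_Icc_succ_top (by omega), add_assoc]

lemma arrivalSlot_mem (I : Instance) {i t : ℕ} (ht : 1 ≤ t) (hi : i < I.arrived t) :
    1 ≤ I.arrivalSlot i ∧ i < I.arrived (I.arrivalSlot i) :=
  Nat.sInf_mem (s := {t : ℕ | 1 ≤ t ∧ i < I.arrived t}) ⟨t, ht, hi⟩

lemma arrivalSlot_le (I : Instance) {i t : ℕ} (ht : 1 ≤ t) (hi : i < I.arrived t) :
    I.arrivalSlot i ≤ t :=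
  Nat.sInf_le (show t ∈ {t : ℕ | 1 ≤ t ∧ i < I.arrived t} from ⟨ht, hi⟩)

lemma arrivalSlot_le_iff (I : Instance) {i s t : ℕ} (hs : 1 ≤ s) (hi : i < I.arrived s)
    (ht : 1 ≤ t) : I.arrivalSlot i ≤ t ↔ i < I.arrived t :=
  ⟨fun h => (I.arrivalSlot_mem hs hi).2.trans_le (I.arrived_mono h), I.arrivalSlot_le ht⟩

/-- The first slot of the window of slot `t`, where a window consists of consecutive OFF slots
and the next ON slot. It is the value of the pointer `t̂` in slot `t`; beyond the horizon the last
slot counts as the end of a window, whether it is ON or not. -/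
def winStart (I : Instance) : ℕ → ℕ
  | 0 => 1
  | t + 1 => if 0 < t ∧ (I.on t = true ∨ t = I.T) then t + 1 else I.winStart t

lemma winStart_one (I : Instance) : I.winStart 1 = 1 := by simp [winStart]

lemma one_le_winStart (I : Instance) (t : ℕ) : 1 ≤ I.winStart t := by
  induction t with
  | zero => exact le_rfl
  | succ t ih => rw [winStart]; split_ifs <;> omega

lemma winStart_le (I : Instance) {t : ℕ} (ht : 1 ≤ t) : I.winStart t ≤ t := by
  induction t with
  | zero => omega
  | succ t ih =>
    rw [winStart]
    split_ifs with h
    · exact le_rfl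
    · rcases Nat.eq_zero_or_pos t with rfl | h0
      · simp [winStart]
      · exact (ih h0).trans (by omega)

lemma winStart_succ_of_end (I : Instance) {t : ℕ} (ht : 1 ≤ t) (h : I.on t = true ∨ t = I.T) :
    I.winStart (t + 1) = t + 1 := by
  rw [winStart, if_pos ⟨ht, h⟩]

lemma winStart_succ_of_not_end (I : Instance) {t : ℕ} (h : ¬(I.on t = true ∨ t = I.T)) :
    I.winStart (t + 1) = I.winStart t := by
  rw [winStart, if_neg fun h' => h h'.2]

lemma on_eq_false_of_winStart_le (I : Instance) {t s : ℕ} (hs : I.winStart t ≤ s) (hst : s < t) :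
    I.on s = false := by
  induction t with
  | zero => omega
  | succ t ih =>
    rw [winStart] at hs
    split_ifs at hs with h
    · omega
    · rcases Nat.lt_succ_iff_lt_or_eq.1 hst with h1 | rfl
      · exact ih hs h1
      · have := (I.one_le_winStart s)
        by_contra hon
        exact h ⟨by omega, Or.inl (by simpa using hon)⟩

lemma winLength_le_maxOff (I : Instance) {t : ℕ} (ht : 1 ≤ t) (hT : t ≤ I.T) :
    t + 1 - I.winStart t ≤ I.maxOff := by
  refine Finset.le_sup (f := fun p : ℕ × ℕ => p.2 + 1 - p.1) (b := (I.winStart t, t)) ?_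
  have h1 := I.one_le_winStart t
  have h2 := I.winStart_le ht
  simp only [Finset.mem_filter, Finset.mem_product, Finset.mem_Icc, Finset.mem_Ico]
  exact ⟨⟨⟨h1, h2.trans hT⟩, ht, hT⟩, h2, fun s hs => I.on_eq_false_of_winStart_le hs.1 hs.2⟩

lemma arrived_sub_le (I : Instance) {s t : ℕ} (hst : s ≤ t) (hT : t ≤ I.T) :
    I.arrived t ≤ I.arrived s + I.maxIncrement * (t - s) := by
  induction t, hst using Nat.le_induction with
  | base => simp
  | succ t hst ih =>
    have h1 : I.increment (t + 1) ≤ I.maxIncrement :=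
      (Finset.le_sup (f := I.increment) (Finset.mem_Icc.2 ⟨by omega, hT⟩)).trans
        (le_max_right _ _)
    have h2 := ih (by omega)
    have h3 : t + 1 - s = (t - s) + 1 := by omega
    rw [arrived_succ, h3, mul_add, mul_one]
    omega

/-- The number of conditional increments made for packet `i` in slot `t` of the virtual run. It is
that of the algorithm, except that the horizon always ends with the activations of an ON slot for
the packets which arrived before the last window. -/
noncomputable def reps (I : Instance) (t i : ℕ) : ℕ :=
  if I.arrivalSlot i < I.winStart t then
    (if I.on t = true ∨ t = I.T then t + 1 - I.winStart t else 0)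
  else if I.on t = true then 1 else 0

end Instance

/-! ### The virtual run -/

lemma cumulative_update (x : ℕ → ℝ) {s t : ℕ} (h : s ≤ t) (v : ℝ) :
    cumulative (Function.update x t v) s t = cumulative x s t + (v - x t) := by
  have ht : t ∈ Finset.Icc s t := Finset.mem_Icc.2 ⟨h, le_rfl⟩
  have e : ∑ τ ∈ (Finset.Icc s t).erase t, Function.update x t v τ
      = ∑ τ ∈ (Finset.Icc s t).erase t, x τ :=
    Finset.sum_congr rfl fun τ hτ => Function.update_of_ne (Finset.ne_of_mem_erase hτ) _ _
  rw [cumulative, cumulative, ← Finset.add_sum_erase _ _ ht, ← Finset.add_sum_erase _ x ht, e,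
    Function.update_self]
  ring

/-- The change of `x` made for packet `i` in slot `t` of the virtual run. -/
noncomputable def virtStep (I : Instance) (θ CM : ℝ) (t : ℕ) (x : ℕ → ℝ) (i : ℕ) : ℕ → ℝ :=
  Function.update x t (x t +
    ((bump θ CM)^[I.reps t i] (cumulative x (I.arrivalSlot i) t)
      - cumulative x (I.arrivalSlot i) t))

/-- The variables `x` at the end of slot `t` of the virtual run. -/
noncomputable def virtRun (I : Instance) (θ CM : ℝ) : ℕ → ℕ → ℝ
  | 0 => fun _ => 0
  | t + 1 => (List.range (I.arrived (t + 1))).foldl (virtStep I θ CM (t + 1)) (virtRun I θ CM t)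

/-- The variables `x` after the first `k` packets of slot `t` of the virtual run. -/
noncomputable def virtPart (I : Instance) (θ CM : ℝ) (t k : ℕ) : ℕ → ℝ :=
  (List.range k).foldl (virtStep I θ CM t) (virtRun I θ CM (t - 1))

/-- The cumulative sum of packet `i` when it is processed in slot `t` of the virtual run. -/
noncomputable def level (I : Instance) (θ CM : ℝ) (t i : ℕ) : ℝ :=
  cumulative (virtPart I θ CM t i) (I.arrivalSlot i) t

/-- The amount by which `x(t)` increases on behalf of packet `i` in the virtual run. -/
noncomputable def gain (I : Instance) (θ CM : ℝ) (t i : ℕ) : ℝ :=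
  (bump θ CM)^[I.reps t i] (level I θ CM t i) - level I θ CM t i

/-- The number of effective increments of `x(t)` on behalf of packet `i` in the virtual run. -/
noncomputable def fires (I : Instance) (θ CM : ℝ) (t i : ℕ) : ℕ :=
  bumpCount θ CM (level I θ CM t i) (I.reps t i)

/-- The sum of the final values of `x` over the slots `s, …, t - 1` of the virtual run. -/
noncomputable def sumGain (I : Instance) (θ CM : ℝ) (s t : ℕ) : ℝ :=
  ∑ τ ∈ Finset.Ico s t, ∑ i ∈ Finset.range (I.arrived τ), gain I θ CM τ i

section virtual

variable {I : Instance} {θ CM : ℝ}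

lemma virtPart_succ (t k : ℕ) : virtPart I θ CM t (k + 1)
    = Function.update (virtPart I θ CM t k) t (virtPart I θ CM t k t + gain I θ CM t k) := by
  rw [virtPart, List.range_succ, List.foldl_append]
  rfl

lemma virtPart_zero (t : ℕ) : virtPart I θ CM t 0 = virtRun I θ CM (t - 1) := rfl

lemma virtRun_eq_virtPart {t : ℕ} (ht : 1 ≤ t) :
    virtRun I θ CM t = virtPart I θ CM t (I.arrived t) := by
  obtain ⟨t, rfl⟩ := Nat.exists_eq_add_of_le' ht
  rfl

lemma virtPart_of_ne (k : ℕ) {s t : ℕ} (h : s ≠ t) :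
    virtPart I θ CM t k s = virtRun I θ CM (t - 1) s := by
  induction k with
  | zero => rfl
  | succ k ih => rw [virtPart_succ, Function.update_of_ne h, ih]

lemma virtRun_of_lt {s t : ℕ} (h : t < s) : virtRun I θ CM t s = 0 := by
  induction t with
  | zero => rfl
  | succ t ih =>
    rw [virtRun_eq_virtPart (by omega), virtPart_of_ne _ (by omega), Nat.add_sub_cancel,
      ih (by omega)]

lemma virtRun_of_le {s t : ℕ} (h : s ≤ t) : virtRun I θ CM t s = virtRun I θ CM s s := by
  induction t, h using Nat.le_induction with
  | base => rfl
  | succ t h ih =>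
    rw [virtRun_eq_virtPart (by omega), virtPart_of_ne _ (by omega), Nat.add_sub_cancel, ih]

lemma virtPart_self {t : ℕ} (ht : 1 ≤ t) (k : ℕ) :
    virtPart I θ CM t k t = ∑ i ∈ Finset.range k, gain I θ CM t i := by
  induction k with
  | zero => rw [virtPart_zero, virtRun_of_lt (by omega), Finset.sum_range_zero]
  | succ k ih => rw [virtPart_succ, Function.update_self, ih, Finset.sum_range_succ]

lemma virtRun_self {t : ℕ} (ht : 1 ≤ t) :
    virtRun I θ CM t t = ∑ i ∈ Finset.range (I.arrived t), gain I θ CM t i := by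
  rw [virtRun_eq_virtPart ht, virtPart_self ht]

lemma cumulative_virtPart {s t : ℕ} (hs : 1 ≤ s) (hst : s ≤ t) (k : ℕ) :
    cumulative (virtPart I θ CM t k) s t
      = sumGain I θ CM s t + ∑ j ∈ Finset.range k, gain I θ CM t j := by
  have e : Finset.Icc s t = insert t (Finset.Ico s t) := by
    ext τ; simp only [Finset.mem_Icc, Finset.mem_insert, Finset.mem_Ico]; omega
  rw [cumulative, e, Finset.sum_insert (by simp), virtPart_self (hs.trans hst), add_comm, sumGain]
  congr 1
  refine Finset.sum_congr rfl fun τ hτ => ?_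
  have hτ' := Finset.mem_Ico.1 hτ
  rw [virtPart_of_ne _ (by omega), virtRun_of_le (by omega), virtRun_self (by omega)]

lemma level_eq {i t : ℕ} (ht : 1 ≤ t) (hi : i < I.arrived t) :
    level I θ CM t i
      = sumGain I θ CM (I.arrivalSlot i) t + ∑ j ∈ Finset.range i, gain I θ CM t j :=
  cumulative_virtPart (I.arrivalSlot_mem ht hi).1 (I.arrivalSlot_le ht hi) i

lemma virtPart_nonneg (hC : 0 < CM) (hθ : 0 < θ) (t k s : ℕ) : 0 ≤ virtPart I θ CM t k s := by
  have key : ∀ t, (∀ s, 0 ≤ virtRun I θ CM (t - 1) s) → ∀ k s, 0 ≤ virtPart I θ CM t k s := by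
    intro t ht k
    induction k with
    | zero => exact ht
    | succ k ih =>
      intro s
      have h1 : 0 ≤ level I θ CM t k := by
        unfold level cumulative
        exact Finset.sum_nonneg fun τ _ => ih τ
      have h2 := le_iterate_bump hC hθ h1 (I.reps t k)
      rw [virtPart_succ, gain, Function.update_apply]
      split_ifs
      · linarith [ih t]
      · exact ih s
  have run : ∀ t s, 0 ≤ virtRun I θ CM t s := by
    intro t
    induction t with
    | zero => exact fun s => le_rfl
    | succ t ih => exact key (t + 1) ih _
  exact key t (run _) k s

lemma level_nonneg (hC : 0 < CM) (hθ : 0 < θ) (t i : ℕ) : 0 ≤ level I θ CM t i := by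
  unfold level cumulative
  exact Finset.sum_nonneg fun τ _ => virtPart_nonneg hC hθ t i τ

lemma gain_nonneg (hC : 0 < CM) (hθ : 0 < θ) (t i : ℕ) : 0 ≤ gain I θ CM t i :=
  sub_nonneg.2 (le_iterate_bump hC hθ (level_nonneg hC hθ t i) _)

lemma sumGain_nonneg (hC : 0 < CM) (hθ : 0 < θ) (s t : ℕ) : 0 ≤ sumGain I θ CM s t :=
  Finset.sum_nonneg fun _ _ => Finset.sum_nonneg fun _ _ => gain_nonneg hC hθ _ _

lemma sumGain_le (hC : 0 < CM) (hθ : 0 < θ) {s s' t t' : ℕ} (hs : s' ≤ s) (ht : t ≤ t') :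
    sumGain I θ CM s t ≤ sumGain I θ CM s' t' :=
  Finset.sum_le_sum_of_subset_of_nonneg (Finset.Ico_subset_Ico hs ht) fun _ _ _ =>
    Finset.sum_nonneg fun _ _ => gain_nonneg hC hθ _ _

lemma sumGain_succ {s t : ℕ} (h : s ≤ t) : sumGain I θ CM s (t + 1)
    = sumGain I θ CM s t + ∑ i ∈ Finset.range (I.arrived t), gain I θ CM t i :=
  Finset.sum_Ico_succ_top h _

lemma sumGain_self (s : ℕ) : sumGain I θ CM s s = 0 := by simp [sumGain]

lemma sumGain_le_level (hC : 0 < CM) (hθ : 0 < θ) {i t : ℕ} (ht : 1 ≤ t)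
    (hi : i < I.arrived t) : sumGain I θ CM (I.arrivalSlot i) t ≤ level I θ CM t i := by
  rw [level_eq ht hi]
  linarith [Finset.sum_nonneg fun j (_ : j ∈ Finset.range i) => gain_nonneg (I := I) hC hθ t j]

lemma iterate_level_le (hC : 0 < CM) (hθ : 0 < θ) {i t : ℕ} (ht : 1 ≤ t)
    (hi : i < I.arrived t) : (bump θ CM)^[I.reps t i] (level I θ CM t i)
      ≤ sumGain I θ CM (I.arrivalSlot i) (t + 1) := by
  have e : (bump θ CM)^[I.reps t i] (level I θ CM t i)
      = level I θ CM t i + gain I θ CM t i := by rw [gain]; ring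
  rw [e, level_eq ht hi, sumGain_succ (I.arrivalSlot_le ht hi), add_assoc,
    ← Finset.sum_range_succ]
  refine add_le_add le_rfl ?_
  exact Finset.sum_le_sum_of_subset_of_nonneg (Finset.range_subset_range.2 hi)
    fun _ _ _ => gain_nonneg hC hθ _ _

lemma level_le_sumGain (hC : 0 < CM) (hθ : 0 < θ) {i t : ℕ} (ht : 1 ≤ t)
    (hi : i < I.arrived t) : level I θ CM t i ≤ sumGain I θ CM (I.arrivalSlot i) (t + 1) :=
  (le_iterate_bump hC hθ (level_nonneg hC hθ t i) _).trans (iterate_level_le hC hθ ht hi)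

lemma gain_of_reps_eq_zero {t i : ℕ} (h : I.reps t i = 0) : gain I θ CM t i = 0 := by
  simp [gain, h]

lemma fires_le (t i : ℕ) : fires I θ CM t i ≤ I.reps t i := bumpCount_le _ _

end virtual


/-! ### The algorithm and the virtual run -/

/-- The state of the algorithm after the first `k` packets of slot `t`. -/
noncomputable def algPart (I : Instance) (Cm CM : ℝ) (t k : ℕ) : State :=
  (List.range k).foldl (packetStep I Cm CM t)
    { run I Cm CM (t - 1) with
      ptr := if 1 < t ∧ I.on (t - 1) = true then t else (run I Cm CM (t - 1)).ptr }

/-- The part of the objective value that is due to packet `i` in slot `t`. -/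
noncomputable def packetCost (I : Instance) (Cm CM : ℝ) (t i : ℕ) : ℝ :=
  (if I.on t = true then I.cost t * gain I (theta Cm CM) CM t i else 0)
    + max 0 (1 - if I.on t = true then level I (theta Cm CM) CM t i
        else sumGain I (theta Cm CM) CM (I.arrivalSlot i) t)

section algorithm

variable {I : Instance} {Cm CM : ℝ}

lemma algPart_succ (t k : ℕ) :
    algPart I Cm CM t (k + 1) = packetStep I Cm CM t (algPart I Cm CM t k) k := by
  rw [algPart, List.range_succ, List.foldl_append]
  rfl

lemma run_eq_algPart {t : ℕ} (ht : 1 ≤ t) :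
    run I Cm CM t = algPart I Cm CM t (I.arrived t) := by
  obtain ⟨t, rfl⟩ := Nat.exists_eq_add_of_le' ht
  rfl

lemma iterate_activate {s t : ℕ} (h : s ≤ t) (x : ℕ → ℝ) (n : ℕ) :
    (activate Cm CM s t)^[n] x = Function.update x t (x t +
      ((bump (theta Cm CM) CM)^[n] (cumulative x s t) - cumulative x s t)) := by
  induction n with
  | zero => simp
  | succ n ih =>
    rw [Function.iterate_succ_apply', Function.iterate_succ_apply', ih, activate,
      cumulative_update _ h, bump]
    have e : cumulative x s t + (x t + ((bump (theta Cm CM) CM)^[n] (cumulative x s t)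
        - cumulative x s t) - x t) = (bump (theta Cm CM) CM)^[n] (cumulative x s t) := by ring
    rw [e]
    split_ifs with h1
    · rw [Function.update_idem, Function.update_self]
      congr 1
      ring
    · rfl

lemma packetStep_ptr (t i : ℕ) (σ : State) : (packetStep I Cm CM t σ i).ptr = σ.ptr := by
  simp only [packetStep]
  split_ifs <;> rfl

lemma algPart_ptr_eq (t k : ℕ) : (algPart I Cm CM t k).ptr = (algPart I Cm CM t 0).ptr := by
  induction k with
  | zero => rfl
  | succ k ih => rw [algPart_succ, packetStep_ptr, ih]

lemma algPart_ptr {t : ℕ} (ht : 1 ≤ t) (hT : t ≤ I.T) (k : ℕ) :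
    (algPart I Cm CM t k).ptr = I.winStart t := by
  induction t, ht using Nat.le_induction generalizing k with
  | base => rw [algPart_ptr_eq, I.winStart_one]; simp [algPart, run]
  | succ t ht ih =>
    have e : (algPart I Cm CM (t + 1) 0).ptr
        = if 1 < t + 1 ∧ I.on t = true then t + 1 else (run I Cm CM t).ptr := rfl
    rw [algPart_ptr_eq, e, run_eq_algPart ht, ih (by omega), Instance.winStart]
    have h1 : t ≠ I.T := by omega
    simp only [h1, or_false]
    congr 1
    simp

/-- An ON slot treats a packet as the virtual run does. -/
lemma packetStep_x_of_on {t i : ℕ} (ht : 1 ≤ t) (hi : i < I.arrived t)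
    (hon : I.on t = true) {σ : State} (hσ : σ.ptr = I.winStart t) :
    (packetStep I Cm CM t σ i).x = virtStep I (theta Cm CM) CM t σ.x i := by
  have hle := I.arrivalSlot_le ht hi
  simp only [packetStep, virtStep]
  split_ifs with h1 h2
  · rw [iterate_activate hle, Instance.reps, ← hσ, if_pos h2, if_pos (Or.inl hon)]
  · rw [← Function.iterate_one (activate Cm CM (I.arrivalSlot i) t), iterate_activate hle,
      Instance.reps, ← hσ, if_neg h2, if_pos hon]
  · rw [iterate_bump_of_one_le (not_lt.1 h1)]
    simp

lemma packetStep_x_of_off {t : ℕ} (i : ℕ) (hoff : ¬ I.on t = true) (σ : State) :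
    (packetStep I Cm CM t σ i).x = σ.x := by
  simp only [packetStep, if_neg hoff]
  split_ifs <;> rfl

lemma reps_of_off {t : ℕ} (i : ℕ) (hoff : ¬ I.on t = true) (hT : t ≠ I.T) : I.reps t i = 0 := by
  simp [Instance.reps, hoff, hT]

lemma algPart_x {t : ℕ} (ht : 1 ≤ t) (hT : t ≤ I.T) (hend : t = I.T → I.on t = true)
    (hx : (run I Cm CM (t - 1)).x = virtRun I (theta Cm CM) CM (t - 1)) {k : ℕ}
    (hk : k ≤ I.arrived t) :
    (algPart I Cm CM t k).x = virtPart I (theta Cm CM) CM t k := by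
  induction k with
  | zero => exact hx
  | succ k ih =>
    rw [algPart_succ]
    by_cases hon : I.on t = true
    · rw [packetStep_x_of_on ht hk hon (algPart_ptr ht hT k), ih (by omega), virtPart,
        virtPart, List.range_succ, List.foldl_append]
      rfl
    · rw [packetStep_x_of_off k hon, ih (by omega), virtPart_succ,
        gain_of_reps_eq_zero (reps_of_off k hon fun h => hon (hend h))]
      simp

lemma algPart_x_of_off {t : ℕ} (hoff : ¬ I.on t = true) (k : ℕ) :
    (algPart I Cm CM t k).x = (run I Cm CM (t - 1)).x := by
  induction k with
  | zero => rfl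
  | succ k ih => rw [algPart_succ, packetStep_x_of_off k hoff, ih]

lemma run_x {t : ℕ} (hT : t ≤ I.T) (hend : t = I.T → I.on t = true) :
    (run I Cm CM t).x = virtRun I (theta Cm CM) CM t := by
  induction t with
  | zero => rfl
  | succ t ih =>
    rw [run_eq_algPart (by omega), virtRun_eq_virtPart (by omega)]
    exact algPart_x (by omega) hT hend (ih (by omega) (by omega)) le_rfl

lemma algPart_x_of_ne {t s : ℕ} (k : ℕ) (h : s ≠ t) :
    (algPart I Cm CM t k).x s = (run I Cm CM (t - 1)).x s := by
  induction k with
  | zero => rfl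
  | succ k ih =>
    rw [algPart_succ, ← ih]
    simp only [packetStep]
    have hact : ∀ n x, ((activate Cm CM (I.arrivalSlot k) t)^[n] x) s = x s := by
      intro n x
      induction n with
      | zero => rfl
      | succ n ihn =>
        rw [Function.iterate_succ_apply', activate]
        split_ifs
        · rw [Function.update_of_ne h, ihn]
        · exact ihn
    split_ifs
    · exact hact _ _
    · exact hact 1 _
    · rfl
    · rfl

lemma run_x_of_le {s t : ℕ} (h : s ≤ t) : (run I Cm CM t).x s = (run I Cm CM s).x s := by
  induction t, h using Nat.le_induction with
  | base => rfl
  | succ t h ih =>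
    rw [run_eq_algPart (by omega), algPart_x_of_ne _ (by omega), Nat.add_sub_cancel, ih]

lemma packetStep_z (t : ℕ) (σ : State) (i : ℕ) : (packetStep I Cm CM t σ i).z
    = if cumulative σ.x (I.arrivalSlot i) t < 1 then
        Function.update σ.z i
          (Function.update (σ.z i) t (1 - cumulative σ.x (I.arrivalSlot i) t))
      else σ.z := by
  by_cases h : cumulative σ.x (I.arrivalSlot i) t < 1
  · simp only [packetStep, if_pos h]
  · simp only [packetStep, if_neg h]

lemma algPart_z_of_ne {t s : ℕ} (k i : ℕ) (h : s ≠ t) :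
    (algPart I Cm CM t k).z i s = (run I Cm CM (t - 1)).z i s := by
  induction k with
  | zero => rfl
  | succ k ih =>
    rw [algPart_succ, ← ih, packetStep_z]
    split_ifs
    · rcases eq_or_ne i k with rfl | hik
      · simp [Function.update_of_ne h]
      · simp [Function.update_of_ne hik]
    · rfl

lemma run_z_of_le {s t : ℕ} (h : s ≤ t) (i : ℕ) :
    (run I Cm CM t).z i s = (run I Cm CM s).z i s := by
  induction t, h using Nat.le_induction with
  | base => rfl
  | succ t h ih =>
    rw [run_eq_algPart (by omega), algPart_z_of_ne _ _ (by omega), Nat.add_sub_cancel, ih]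

lemma run_z_of_lt {s t : ℕ} (h : t < s) (i : ℕ) : (run I Cm CM t).z i s = 0 := by
  induction t with
  | zero => rfl
  | succ t ih =>
    rw [run_eq_algPart (by omega), algPart_z_of_ne _ _ (by omega), Nat.add_sub_cancel,
      ih (by omega)]

lemma algPart_z_self {t : ℕ} (ht : 1 ≤ t) (k i : ℕ) : (algPart I Cm CM t k).z i t
    = if i < k then max 0 (1 - cumulative (algPart I Cm CM t i).x (I.arrivalSlot i) t) else 0 := by
  induction k with
  | zero => exact run_z_of_lt (by omega) i
  | succ k ih =>
    rw [algPart_succ, packetStep_z]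
    rcases eq_or_ne i k with rfl | hik
    · rw [if_neg (lt_irrefl i)] at ih
      rw [if_pos (Nat.lt_succ_self i)]
      split_ifs with h
      · rw [max_eq_right (by linarith)]
        simp
      · rw [max_eq_left (by linarith), ih]
    · have e : i < k + 1 ↔ i < k := by omega
      simp only [e]
      rw [← ih]
      split_ifs
      · simp [Function.update_of_ne hik]
      · rfl

/-- The objective value, split into the contributions of the packets and slots. -/
lemma algValue_eq : algValue I Cm CM
    = ∑ t ∈ Finset.Icc 1 I.T, ∑ i ∈ Finset.range (I.arrived t), packetCost I Cm CM t i := by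
  rw [algValue, Instance.lpObjective]
  refine Finset.sum_congr rfl fun t ht => ?_
  obtain ⟨h1, hT⟩ := Finset.mem_Icc.1 ht
  have hprev : (run I Cm CM (t - 1)).x = virtRun I (theta Cm CM) CM (t - 1) :=
    run_x (by omega) (by omega)
  simp only [packetCost, Finset.sum_add_distrib]
  congr 1
  · rw [run_x_of_le hT]
    by_cases hon : I.on t = true
    · simp only [if_pos hon]
      rw [run_x hT fun _ => hon, virtRun_self h1, Finset.mul_sum]
    · simp only [if_neg hon, Finset.sum_const_zero]
      rw [run_eq_algPart h1, algPart_x_of_off hon, hprev, virtRun_of_lt (by omega), mul_zero]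
  · refine Finset.sum_congr rfl fun i hi => ?_
    have hi' := Finset.mem_range.1 hi
    rw [run_z_of_le hT, run_eq_algPart h1, algPart_z_self h1, if_pos hi']
    congr 2
    by_cases hon : I.on t = true
    · rw [if_pos hon, algPart_x h1 hT (fun _ => hon) hprev hi'.le]
      rfl
    · rw [if_neg hon, algPart_x_of_off hon, hprev, ← virtPart_zero,
        cumulative_virtPart (I.arrivalSlot_mem h1 hi').1 (I.arrivalSlot_le h1 hi')]
      simp

end algorithm


/-! ### The cost of a single packet -/

/-- Packet `i` is still in the queue at the end of slot `t` under the schedule `D`. -/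
abbrev Uncovered (I : Instance) (D : Finset ℕ) (i t : ℕ) : Prop :=
  ∀ τ ∈ D, τ ≤ t → τ < I.arrivalSlot i

/-- Slot `t` is OFF and no ON slot precedes it since the arrival of packet `i`, so that the
packet waits in slot `t` under every schedule. -/
abbrev Unavoidable (I : Instance) (t i : ℕ) : Prop :=
  I.winStart t ≤ I.arrivalSlot i ∧ ¬ I.on t = true

/-- The growth in slot `t` of the cumulative sum of packet `i`, truncated at `1`, if the packet
arrived before the window of slot `t`. -/
noncomputable def excess (I : Instance) (θ CM : ℝ) (t i : ℕ) : ℝ :=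
  if I.arrivalSlot i < I.winStart t then
    min 1 (sumGain I θ CM (I.arrivalSlot i) (t + 1)) - min 1 (sumGain I θ CM (I.arrivalSlot i) t)
  else 0

lemma sum_Icc_le_of_residual {f g ρ : ℕ → ℝ} {s T : ℕ} (hs : s ≤ T + 1)
    (h : ∀ t, s ≤ t → t ≤ T → f t + ρ t ≤ g t + ρ (t + 1)) :
    ∑ t ∈ Finset.Icc s T, f t + ρ s ≤ ∑ t ∈ Finset.Icc s T, g t + ρ (T + 1) := by
  have key : ∀ n, s ≤ n → n ≤ T + 1 →
      ∑ t ∈ Finset.Ico s n, f t + ρ s ≤ ∑ t ∈ Finset.Ico s n, g t + ρ n := by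
    intro n hn
    induction n, hn using Nat.le_induction with
    | base => simp
    | succ n hn ih =>
      intro hT
      rw [Finset.sum_Ico_succ_top hn, Finset.sum_Ico_succ_top hn]
      linarith [ih (by omega), h n hn (by omega)]
  have e : Finset.Icc s T = Finset.Ico s (T + 1) := by
    ext; simp only [Finset.mem_Icc, Finset.mem_Ico]; omega
  rw [e]
  exact key _ hs le_rfl

section packet

variable {I : Instance} {Cm CM : ℝ}

lemma sum_gain_eq_zero_of_off {θ : ℝ} {t : ℕ} (hoff : ¬ I.on t = true) (hT : t ≠ I.T) :
    ∑ i ∈ Finset.range (I.arrived t), gain I θ CM t i = 0 :=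
  Finset.sum_eq_zero fun i _ => gain_of_reps_eq_zero (reps_of_off i hoff hT)

lemma sumGain_eq_zero_of_fresh {θ : ℝ} {t i : ℕ} (hT : t ≤ I.T)
    (h : I.winStart t ≤ I.arrivalSlot i) : sumGain I θ CM (I.arrivalSlot i) t = 0 :=
  Finset.sum_eq_zero fun s hs => by
    have hs' := Finset.mem_Ico.1 hs
    refine sum_gain_eq_zero_of_off ?_ (by omega)
    simp [I.on_eq_false_of_winStart_le (h.trans hs'.1) hs'.2]

lemma excess_nonneg {θ : ℝ} (hC : 0 < CM) (hθ : 0 < θ) (t i : ℕ) : 0 ≤ excess I θ CM t i := by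
  rw [excess]
  split_ifs
  · exact sub_nonneg.2 (min_le_min le_rfl (sumGain_le hC hθ le_rfl (by omega)))
  · exact le_rfl

/-- The unpaid waiting cost of packet `i` in the slots of the window of slot `t` before `t`. -/
noncomputable def unpaid (I : Instance) (θ CM : ℝ) (i t : ℕ) : ℝ :=
  if I.arrivalSlot i < I.winStart t then
    ((t - I.winStart t : ℕ) : ℝ) * (1 - min 1 (sumGain I θ CM (I.arrivalSlot i) t))
  else 0

lemma unpaid_nonneg {θ : ℝ} (i t : ℕ) : 0 ≤ unpaid I θ CM i t := by
  rw [unpaid]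
  split_ifs
  · exact mul_nonneg (Nat.cast_nonneg _) (sub_nonneg.2 (min_le_left _ _))
  · exact le_rfl

lemma max_zero_one_sub (u : ℝ) : max 0 (1 - u) = 1 - min 1 u := by
  rcases le_total u 1 with h | h
  · rw [min_eq_right h, max_eq_right (by linarith)]
  · rw [min_eq_left h, max_eq_left (by linarith), sub_self]

lemma packetCost_step (hm : 0 < Cm) (hM : 0 < CM) {t i : ℕ} (ht : 1 ≤ t) (hT : t ≤ I.T)
    (hi : i < I.arrived t) (hc : I.cost t ≤ CM) :
    packetCost I Cm CM t i + unpaid I (theta Cm CM) CM i t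
      ≤ ((if Unavoidable I t i then 1 else 0)
          + (1 + 1 / theta Cm CM) * fires I (theta Cm CM) CM t i
          + I.maxOff * excess I (theta Cm CM) CM t i)
        + unpaid I (theta Cm CM) CM i (t + 1) := by
  have hθ := theta_pos hm hM
  have hgain := gain_nonneg (I := I) hM hθ t i
  have hlev := sumGain_le_level (I := I) hM hθ ht hi
  have hsum := sumGain_nonneg (I := I) hM hθ (I.arrivalSlot i) t
  have hexc := excess_nonneg (I := I) hM hθ t i
  have hunp := unpaid_nonneg (I := I) (CM := CM) (θ := theta Cm CM) i (t + 1)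
  have hfire : 0 ≤ (1 + 1 / theta Cm CM) * fires I (theta Cm CM) CM t i := by positivity
  have hL0 : (0 : ℝ) ≤ I.maxOff := Nat.cast_nonneg _
  by_cases hold : I.arrivalSlot i < I.winStart t
  · have hun : unpaid I (theta Cm CM) CM i t = ((t - I.winStart t : ℕ) : ℝ)
        * (1 - min 1 (sumGain I (theta Cm CM) CM (I.arrivalSlot i) t)) := if_pos hold
    by_cases hend : I.on t = true ∨ t = I.T
    · have hreps : I.reps t i = t + 1 - I.winStart t := by
        rw [Instance.reps, if_pos hold, if_pos hend]
      have key := window_cost_le hM hθ hsum hlev (I.reps t i) (iterate_level_le hM hθ ht hi)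
      have hex : excess I (theta Cm CM) CM t i
          = min 1 (sumGain I (theta Cm CM) CM (I.arrivalSlot i) (t + 1))
            - min 1 (sumGain I (theta Cm CM) CM (I.arrivalSlot i) t) := if_pos hold
      rw [← hex] at key
      have hcost : packetCost I Cm CM t i ≤ CM * gain I (theta Cm CM) CM t i
          + (1 - min 1 (sumGain I (theta Cm CM) CM (I.arrivalSlot i) t)) := by
        rw [packetCost, max_zero_one_sub]
        split_ifs
        · have h1 := mul_le_mul_of_nonneg_right hc hgain
          have h2 := min_le_min (le_refl (1 : ℝ)) hlev
          linarith
        · have := mul_nonneg hM.le hgain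
          linarith
      have hwin := I.winLength_le_maxOff ht hT
      have hL : (I.reps t i : ℝ) * excess I (theta Cm CM) CM t i
          ≤ I.maxOff * excess I (theta Cm CM) CM t i := by
        rw [hreps]
        exact mul_le_mul_of_nonneg_right (by exact_mod_cast hwin) hexc
      have hr : (I.reps t i : ℝ) = ((t - I.winStart t : ℕ) : ℝ) + 1 := by
        have := I.winStart_le ht
        rw [hreps, show t + 1 - I.winStart t = (t - I.winStart t) + 1 by omega]
        push_cast; ring
      have hind : (0 : ℝ) ≤ if Unavoidable I t i then 1 else 0 := by split_ifs <;> norm_num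
      rw [← gain, ← fires] at key
      have e : (I.reps t i : ℝ) * (1 - min 1 (sumGain I (theta Cm CM) CM (I.arrivalSlot i) t))
          = ((t - I.winStart t : ℕ) : ℝ)
              * (1 - min 1 (sumGain I (theta Cm CM) CM (I.arrivalSlot i) t))
            + (1 - min 1 (sumGain I (theta Cm CM) CM (I.arrivalSlot i) t)) := by rw [hr]; ring
      rw [hun]
      linarith
    · have hoff : ¬ I.on t = true := fun h => hend (Or.inl h)
      have hTne : t ≠ I.T := fun h => hend (Or.inr h)
      have hS : sumGain I (theta Cm CM) CM (I.arrivalSlot i) (t + 1)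
          = sumGain I (theta Cm CM) CM (I.arrivalSlot i) t := by
        rw [sumGain_succ (I.arrivalSlot_le ht hi), sum_gain_eq_zero_of_off hoff hTne, add_zero]
      have hun' : unpaid I (theta Cm CM) CM i (t + 1) = (((t - I.winStart t : ℕ) : ℝ) + 1)
          * (1 - min 1 (sumGain I (theta Cm CM) CM (I.arrivalSlot i) t)) := by
        have := I.winStart_le ht
        rw [unpaid, I.winStart_succ_of_not_end hend, if_pos hold, hS,
          show t + 1 - I.winStart t = (t - I.winStart t) + 1 by omega]
        push_cast; ring
      have hcost : packetCost I Cm CM t i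
          = 1 - min 1 (sumGain I (theta Cm CM) CM (I.arrivalSlot i) t) := by
        rw [packetCost, if_neg hoff, if_neg hoff, max_zero_one_sub, zero_add]
      have hind : (0 : ℝ) ≤ if Unavoidable I t i then 1 else 0 := by split_ifs <;> norm_num
      have := mul_nonneg hL0 hexc
      rw [hcost, hun, hun']
      linarith
  · have hun : unpaid I (theta Cm CM) CM i t = 0 := if_neg hold
    have hLe := mul_nonneg hL0 hexc
    by_cases hon : I.on t = true
    · have hreps : I.reps t i = 1 := by rw [Instance.reps, if_neg hold, if_pos hon]
      have key := fresh_cost_le hM hθ (level I (theta Cm CM) CM t i)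
      rw [← hreps, ← gain, ← fires] at key
      have h1 := mul_le_mul_of_nonneg_right hc hgain
      have hind : (0 : ℝ) ≤ if Unavoidable I t i then 1 else 0 := by split_ifs <;> norm_num
      rw [packetCost, if_pos hon, if_pos hon, hun]
      linarith
    · rw [packetCost, if_neg hon, if_neg hon, hun,
        sumGain_eq_zero_of_fresh hT (not_lt.1 hold), if_pos ⟨not_lt.1 hold, hon⟩]
      simp only [sub_zero, zero_add, add_zero, zero_le_one, sup_of_le_right]
      linarith

/-- The cost of a packet: its unavoidable waiting cost, `1 + 1/θ` for each of its effective
increments, and an excess that comes from increments which are withheld until the end of a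
window. -/
lemma sum_packetCost_le (hm : 0 < Cm) (hM : 0 < CM) {i : ℕ} (hi : i < I.arrived I.T)
    (hT : 1 ≤ I.T) (hc : ∀ t ∈ Finset.Icc 1 I.T, I.cost t ≤ CM) :
    ∑ t ∈ Finset.Icc (I.arrivalSlot i) I.T, packetCost I Cm CM t i
      ≤ ∑ t ∈ Finset.Icc (I.arrivalSlot i) I.T, ((if Unavoidable I t i then 1 else 0)
          + (1 + 1 / theta Cm CM) * fires I (theta Cm CM) CM t i
          + I.maxOff * excess I (theta Cm CM) CM t i) := by
  have h1 := (I.arrivalSlot_mem hT hi).1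
  have hle := I.arrivalSlot_le hT hi
  have key := sum_Icc_le_of_residual (s := I.arrivalSlot i) (T := I.T)
    (f := fun t => packetCost I Cm CM t i)
    (g := fun t => (if Unavoidable I t i then 1 else 0)
          + (1 + 1 / theta Cm CM) * fires I (theta Cm CM) CM t i
          + I.maxOff * excess I (theta Cm CM) CM t i)
    (ρ := unpaid I (theta Cm CM) CM i) (by omega) fun t hs ht =>
      packetCost_step hm hM (by omega) ht
        ((I.arrivalSlot_le_iff hT hi (by omega)).1 hs) (hc t (Finset.mem_Icc.2 ⟨by omega, ht⟩))
  have e0 := unpaid_nonneg (I := I) (CM := CM) (θ := theta Cm CM) i (I.arrivalSlot i)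
  have e1 : unpaid I (theta Cm CM) CM i (I.T + 1) = 0 := by
    rw [unpaid, I.winStart_succ_of_end hT (Or.inr rfl), Nat.sub_self, Nat.cast_zero, zero_mul,
      ite_self]
  linarith

end packet


/-! ### Schedules and packets -/

section schedule

variable {I : Instance} {D : Finset ℕ}

/-- The number of slots of the window of slot `t` before `t` in which packet `i`, if it arrived
before that window, waits under the schedule `D`. -/
noncomputable def credit (I : Instance) (D : Finset ℕ) (i t : ℕ) : ℕ :=
  if I.arrivalSlot i < I.winStart t ∧ Uncovered I D i (t - 1) then t - I.winStart t else 0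

lemma credit_step {θ CM : ℝ} (hD : D ⊆ I.onSlots) {t i : ℕ} (ht : 1 ≤ t) (hT : t ≤ I.T) :
    ((if Unavoidable I t i then 1 else 0)
        + (if Uncovered I D i t then fires I θ CM t i else 0)) + credit I D i (t + 1)
      ≤ (if Uncovered I D i t then 1 else 0) + credit I D i t := by
  have hfire : fires I θ CM t i ≤ I.reps t i := fires_le t i
  have hws := I.winStart_le ht
  have hmono : Uncovered I D i t → Uncovered I D i (t - 1) := fun h τ hτ hle =>
    h τ hτ (by omega)
  by_cases hend : I.on t = true ∨ t = I.T
  · have hcr : credit I D i (t + 1) = 0 := by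
      rw [credit, I.winStart_succ_of_end ht hend, Nat.sub_self, ite_self]
    rw [hcr]
    by_cases hold : I.arrivalSlot i < I.winStart t
    · have hreps : I.reps t i = t + 1 - I.winStart t := by
        rw [Instance.reps, if_pos hold, if_pos hend]
      rw [if_neg (fun h => absurd h.1 (not_le.2 hold))]
      by_cases hu : Uncovered I D i t
      · rw [if_pos hu, if_pos hu, credit, if_pos ⟨hold, hmono hu⟩]
        omega
      · rw [if_neg hu]; omega
    · by_cases hon : I.on t = true
      · have hreps : I.reps t i = 1 := by rw [Instance.reps, if_neg hold, if_pos hon]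
        rw [if_neg (fun h => h.2 hon)]
        split_ifs <;> omega
      · have hreps : I.reps t i = 0 := by rw [Instance.reps, if_neg hold, if_neg hon]
        have hu : Uncovered I D i t := fun τ hτ hle => by
          have h1 := (Finset.mem_filter.1 (hD hτ)).2
          by_contra hlt
          rcases hle.lt_or_eq with h | rfl
          · have := I.on_eq_false_of_winStart_le (t := t) (s := τ) (by omega) h
            simp [h1] at this
          · exact hon h1
        rw [if_pos ⟨not_lt.1 hold, hon⟩, if_pos hu, if_pos hu]
        omega
  · have hoff : ¬ I.on t = true := fun h => hend (Or.inl h)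
    have hreps : I.reps t i = 0 := reps_of_off i hoff fun h => hend (Or.inr h)
    have hf : fires I θ CM t i = 0 := by omega
    rw [hf, ite_self, add_zero]
    by_cases hold : I.arrivalSlot i < I.winStart t
    · rw [if_neg (fun h => absurd h.1 (not_le.2 hold)), credit, I.winStart_succ_of_not_end hend,
        Nat.add_sub_cancel, credit]
      by_cases hu : Uncovered I D i t
      · rw [if_pos ⟨hold, hu⟩, if_pos hu, if_pos ⟨hold, hmono hu⟩]
        omega
      · rw [if_neg (fun h => hu h.2)]; omega
    · have hu : Uncovered I D i t := fun τ hτ hle => by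
        have h1 := (Finset.mem_filter.1 (hD hτ)).2
        by_contra hlt
        rcases hle.lt_or_eq with h | rfl
        · have := I.on_eq_false_of_winStart_le (t := t) (s := τ) (by omega) h
          simp [h1] at this
        · exact hoff h1
      rw [if_pos ⟨not_lt.1 hold, hoff⟩, if_pos hu, credit, I.winStart_succ_of_not_end hend,
        if_neg fun h => hold h.1]
      omega

/-- The number of slots in which packet `i` waits under the schedule `D`. -/
noncomputable def waiting (I : Instance) (D : Finset ℕ) (i : ℕ) : ℕ :=
  ∑ t ∈ Finset.Icc (I.arrivalSlot i) I.T, if Uncovered I D i t then 1 else 0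

/-- The unavoidable waiting slots and the effective increments that no update of `D` covers are
paid by the waiting of the packet under `D`. -/
lemma sum_uncovered_le_waiting {θ CM : ℝ} (hD : D ⊆ I.onSlots) {i : ℕ} (hT : 1 ≤ I.T)
    (hi : i < I.arrived I.T) :
    ∑ t ∈ Finset.Icc (I.arrivalSlot i) I.T, ((if Unavoidable I t i then 1 else 0)
        + (if Uncovered I D i t then fires I θ CM t i else 0)) ≤ waiting I D i := by
  have h1 := (I.arrivalSlot_mem hT hi).1
  have hle := I.arrivalSlot_le hT hi
  have key := sum_Icc_le_of_residual (s := I.arrivalSlot i) (T := I.T)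
    (f := fun t => (((if Unavoidable I t i then 1 else 0)
        + (if Uncovered I D i t then fires I θ CM t i else 0) : ℕ) : ℝ))
    (g := fun t => ((if Uncovered I D i t then 1 else 0 : ℕ) : ℝ))
    (ρ := fun t => -(credit I D i t : ℝ)) (by omega) fun t hs ht => by
      have : ((_ : ℕ) : ℝ) ≤ ((_ : ℕ) : ℝ) := Nat.cast_le.2
        (credit_step (I := I) (D := D) (i := i) (t := t) (θ := θ) (CM := CM) hD (by omega) ht)
      rw [Nat.cast_add, Nat.cast_add _ (credit I D i t)] at this
      linarith
  have e0 : credit I D i (I.arrivalSlot i) = 0 := by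
    have := I.winStart_le h1
    rw [credit, if_neg fun h => absurd h.1 (not_lt.2 this)]
  have e1 : credit I D i (I.T + 1) = 0 := by
    rw [credit, I.winStart_succ_of_end hT (Or.inr rfl), Nat.sub_self, ite_self]
  simp only [e0, e1, Nat.cast_zero, neg_zero, add_zero] at key
  rw [waiting]
  exact_mod_cast key

/-- The packets that are in the queue at the end of slot `t`. -/
lemma age_eq_card (hD : D ⊆ I.onSlots) (t : ℕ) :
    I.age D t = ((Finset.range (I.arrived t)).filter
      fun i => ∀ τ ∈ D, τ ≤ t → I.arrived τ ≤ i).card := by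
  have hpos : ∀ τ ∈ D, 1 ≤ τ := fun τ hτ =>
    (Finset.mem_Icc.1 (Finset.mem_filter.1 (hD hτ)).1).1
  induction t with
  | zero =>
    rw [Finset.filter_true_of_mem fun i _ τ hτ h => absurd (hpos τ hτ) (by omega)]
    simp [Instance.age, Instance.arrived]
  | succ t ih =>
    rw [Instance.age]
    split_ifs with h
    · rw [eq_comm, Finset.card_eq_zero, Finset.filter_eq_empty_iff]
      intro i hi hall
      exact absurd (hall _ h le_rfl) (not_le.2 (Finset.mem_range.1 hi))
    · have e : (Finset.range (I.arrived (t + 1))).filter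
            (fun i => ∀ τ ∈ D, τ ≤ t + 1 → I.arrived τ ≤ i)
          = (Finset.range (I.arrived t)).filter (fun i => ∀ τ ∈ D, τ ≤ t → I.arrived τ ≤ i)
            ∪ Finset.Ico (I.arrived t) (I.arrived (t + 1)) := by
        ext i
        have hm := I.arrived_mono (Nat.le_succ t)
        simp only [Finset.mem_filter, Finset.mem_range, Finset.mem_union, Finset.mem_Ico]
        constructor
        · rintro ⟨h1, h2⟩
          by_cases h3 : i < I.arrived t
          · exact Or.inl ⟨h3, fun τ hτ hle => h2 τ hτ (by omega)⟩
          · exact Or.inr ⟨by omega, h1⟩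
        · rintro (⟨h1, h2⟩ | ⟨h1, h2⟩)
          · refine ⟨h1.trans_le hm, fun τ hτ hle => h2 τ hτ ?_⟩
            rcases hle.lt_or_eq with h3 | rfl
            · omega
            · exact absurd hτ h
          · refine ⟨h2, fun τ hτ hle => ?_⟩
            rcases hle.lt_or_eq with h3 | rfl
            · exact (I.arrived_mono (Nat.lt_succ_iff.1 h3)).trans h1
            · exact absurd hτ h
      rw [e, Finset.card_union_of_disjoint, ← ih, Nat.card_Ico, I.arrived_succ]
      · omega
      · rw [Finset.disjoint_left]
        intro i h1 h2
        have h3 := Finset.mem_range.1 (Finset.mem_filter.1 h1).1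
        have h4 := (Finset.mem_Ico.1 h2).1
        omega

lemma sum_slots_eq_sum_packets {M : Type*} [AddCommMonoid M] (I : Instance) (f : ℕ → ℕ → M) :
    ∑ t ∈ Finset.Icc 1 I.T, ∑ i ∈ Finset.range (I.arrived t), f t i
      = ∑ i ∈ Finset.range (I.arrived I.T), ∑ t ∈ Finset.Icc (I.arrivalSlot i) I.T, f t i := by
  rcases Nat.eq_zero_or_pos I.T with h0 | hT
  · rw [h0]
    symm
    refine (Finset.sum_eq_zero fun i hi => ?_).trans (by simp)
    have hi' := Finset.mem_range.1 hi
    have h1 := (I.arrivalSlot_mem (i := i) (t := 1) le_rfl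
      (hi'.trans_le (I.arrived_mono (Nat.zero_le _)))).1
    rw [Finset.Icc_eq_empty (by omega), Finset.sum_empty]
  · refine Finset.sum_comm' fun t i => ?_
    simp only [Finset.mem_Icc, Finset.mem_range]
    constructor
    · rintro ⟨⟨h1, h2⟩, h3⟩
      exact ⟨⟨I.arrivalSlot_le h1 h3, h2⟩, h3.trans_le (I.arrived_mono h2)⟩
    · rintro ⟨⟨h1, h2⟩, h3⟩
      have h4 := (I.arrivalSlot_mem hT h3).1
      exact ⟨⟨by omega, h2⟩, (I.arrivalSlot_le_iff hT h3 (by omega)).1 h1⟩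

/-- The age cost of a schedule is the total waiting time of the packets. -/
lemma sum_age_eq (hD : D ⊆ I.onSlots) :
    ∑ t ∈ Finset.Icc 1 I.T, I.age D t = ∑ i ∈ Finset.range (I.arrived I.T), waiting I D i := by
  unfold waiting
  rw [← sum_slots_eq_sum_packets]
  refine Finset.sum_congr rfl fun t ht => ?_
  obtain ⟨h1, _⟩ := Finset.mem_Icc.1 ht
  rw [age_eq_card hD, Finset.card_filter]
  refine Finset.sum_congr rfl fun i hi => if_congr ?_ rfl rfl
  refine forall₂_congr fun τ hτ => imp_congr_right fun _ => ?_
  have hτ1 := (Finset.mem_Icc.1 (Finset.mem_filter.1 (hD hτ)).1).1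
  have := I.arrivalSlot_le_iff h1 (Finset.mem_range.1 hi) hτ1
  omega

lemma le_totalCost {Cm : ℝ} (hD : D ⊆ I.onSlots) (hc : ∀ t ∈ Finset.Icc 1 I.T, Cm ≤ I.cost t) :
    Cm * D.card + ∑ i ∈ Finset.range (I.arrived I.T), (waiting I D i : ℝ) ≤ I.totalCost D := by
  have h1 := sum_age_eq hD
  have h2 : ∑ i ∈ Finset.range (I.arrived I.T), (waiting I D i : ℝ)
      = ∑ t ∈ Finset.Icc 1 I.T, (I.age D t : ℝ) := by exact_mod_cast h1.symm
  rw [h2, Instance.totalCost, Finset.sum_add_distrib]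
  gcongr
  have hD' : D ⊆ Finset.Icc 1 I.T := hD.trans (Finset.filter_subset _ _)
  rw [← Finset.sum_filter, Finset.filter_mem_eq_inter, Finset.inter_eq_right.2 hD', mul_comm,
    ← nsmul_eq_mul]
  exact Finset.card_nsmul_le_sum _ _ _ fun t ht => hc t (hD' ht)

end schedule


/-! ### Packing of the effective increments -/

section packing

variable {I : Instance} {Cm CM : ℝ}

/-- Induction along the packets of the slots `s, s + 1, …`, in the order of processing. -/
lemma slot_packet_induction (I : Instance) {P : ℕ → ℕ → Prop} {s : ℕ} (h0 : P s 0)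
    (hpacket : ∀ t k, s ≤ t → k < I.arrived t → P t k → P t (k + 1))
    (hslot : ∀ t, s ≤ t → P t (I.arrived t) → P (t + 1) 0) {t : ℕ} (ht : s ≤ t) : P t 0 := by
  induction t, ht using Nat.le_induction with
  | base => exact h0
  | succ t ht ih =>
    refine hslot t ht ?_
    have key : ∀ k, k ≤ I.arrived t → P t k := by
      intro k
      induction k with
      | zero => exact fun _ => ih
      | succ k ihk => exact fun hk => hpacket t k ht hk (ihk (by omega))
    exact key _ le_rfl

/-- At most `C_m + 1` effective increments are made in the slots from `τ` on for packets that have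
arrived by slot `τ`: this is the feasibility, up to rounding, of the dual solution. -/
lemma sum_fires_le (hm : 0 < Cm) (hM : 0 < CM) {τ : ℕ} (hτ : 1 ≤ τ) {t : ℕ} (ht : τ ≤ t) :
    ((∑ s ∈ Finset.Ico τ t, ∑ i ∈ Finset.range (I.arrived s),
      if I.arrivalSlot i ≤ τ then fires I (theta Cm CM) CM s i else 0 : ℕ) : ℝ) ≤ Cm + 1 := by
  have hθ := theta_pos hm hM
  have key := slot_packet_induction I (s := τ) (t := t)
    (P := fun t k => Packed Cm CM
      (∑ s ∈ Finset.Ico τ t, ∑ i ∈ Finset.range (I.arrived s),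
          (if I.arrivalSlot i ≤ τ then fires I (theta Cm CM) CM s i else 0)
        + ∑ i ∈ Finset.range k,
          (if I.arrivalSlot i ≤ τ then fires I (theta Cm CM) CM t i else 0))
      (sumGain I (theta Cm CM) CM τ t + ∑ j ∈ Finset.range k, gain I (theta Cm CM) CM t j))
    (by simpa [sumGain_self] using packed_zero hm)
    (fun t k hst hk ih => by
      rw [Finset.sum_range_succ, Finset.sum_range_succ, ← add_assoc, ← add_assoc]
      by_cases h : I.arrivalSlot k ≤ τ
      · rw [if_pos h]
        refine ih.add hm hM ?_ _
        rw [level_eq (by omega) hk]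
        have := sumGain_le (I := I) hM hθ h (le_refl t)
        linarith
      · rw [if_neg h, add_zero]
        exact ih.mono (by linarith [gain_nonneg (I := I) hM hθ t k]))
    (fun t hst ih => by
      rw [Finset.sum_Ico_succ_top hst, sumGain_succ hst]
      simpa using ih) ht
  simpa using key.card_le

/-- An upper bound on the total of all increments in terms of their number. -/
lemma sumGain_add_inv_le (hm : 0 < Cm) (hM : 0 < CM) {t : ℕ} (ht : 1 ≤ t) :
    sumGain I (theta Cm CM) CM 1 t + 1 / theta Cm CM ≤ 1 / theta Cm CM * (1 + 1 / CM) ^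
      (∑ s ∈ Finset.Ico 1 t, ∑ i ∈ Finset.range (I.arrived s), fires I (theta Cm CM) CM s i) := by
  have hθ := theta_pos hm hM
  have hq : 1 ≤ 1 + 1 / CM := by have : 0 < 1 / CM := by positivity
                                 linarith
  have key := slot_packet_induction I (s := 1) (t := t)
    (P := fun t k => sumGain I (theta Cm CM) CM 1 t
        + ∑ j ∈ Finset.range k, gain I (theta Cm CM) CM t j + 1 / theta Cm CM
      ≤ 1 / theta Cm CM * (1 + 1 / CM) ^
        (∑ s ∈ Finset.Ico 1 t, ∑ i ∈ Finset.range (I.arrived s), fires I (theta Cm CM) CM s i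
        + ∑ i ∈ Finset.range k, fires I (theta Cm CM) CM t i))
    (by simp [sumGain_self])
    (fun t k hst hk ih => by
      rw [Finset.sum_range_succ, Finset.sum_range_succ, ← add_assoc, ← add_assoc, pow_add,
        ← mul_assoc]
      have h1 := (I.arrivalSlot_mem hst hk).1
      have h2 : level I (theta Cm CM) CM t k ≤ sumGain I (theta Cm CM) CM 1 t
          + ∑ j ∈ Finset.range k, gain I (theta Cm CM) CM t j := by
        rw [level_eq hst hk]
        have := sumGain_le (I := I) hM hθ h1 (le_refl t)
        linarith
      have h3 := iterate_bump_add_inv hM hθ (level I (theta Cm CM) CM t k) (I.reps t k)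
      have h4 : gain I (theta Cm CM) CM t k = (level I (theta Cm CM) CM t k + 1 / theta Cm CM)
          * ((1 + 1 / CM) ^ fires I (theta Cm CM) CM t k - 1) := by
        rw [gain, fires]; linarith
      have h5 : 1 ≤ (1 + 1 / CM) ^ fires I (theta Cm CM) CM t k := one_le_pow₀ hq
      refine le_trans ?_ (mul_le_mul_of_nonneg_right ih (by positivity))
      rw [h4]
      nlinarith)
    (fun t hst ih => by
      rw [Finset.sum_Ico_succ_top hst, sumGain_succ hst]
      simpa using ih) ht
  simpa using key

/-- If at most `N ≤ C_m` effective increments are made, they add up to at most `N / C_m`, because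
`θ = q ^ C_m - 1` and `q ^ N` is convex in `N`. -/
lemma sumGain_le_div (hm : 0 < Cm) (hM : 0 < CM) {t : ℕ} (ht : 1 ≤ t) {N : ℝ}
    (hN : ((∑ s ∈ Finset.Ico 1 t, ∑ i ∈ Finset.range (I.arrived s),
      fires I (theta Cm CM) CM s i : ℕ) : ℝ) ≤ N) (hNm : N ≤ Cm) :
    sumGain I (theta Cm CM) CM 1 t ≤ N / Cm := by
  have hθ := theta_pos hm hM
  have hq : 1 ≤ 1 + 1 / CM := by have : 0 < 1 / CM := by positivity
                                 linarith
  have h := sumGain_add_inv_le (I := I) hm hM ht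
  set n := ∑ s ∈ Finset.Ico 1 t, ∑ i ∈ Finset.range (I.arrived s), fires I (theta Cm CM) CM s i
  have hN0 : 0 ≤ N := (Nat.cast_nonneg _).trans hN
  have h1 : (1 + 1 / CM) ^ n ≤ 1 + N / Cm * theta Cm CM := by
    calc (1 + 1 / CM) ^ n = (1 + 1 / CM) ^ (n : ℝ) := (Real.rpow_natCast _ _).symm
      _ ≤ (1 + 1 / CM) ^ N := Real.rpow_le_rpow_of_exponent_le hq hN
      _ = ((1 + 1 / CM) ^ Cm) ^ (N / Cm) := by
          rw [← Real.rpow_mul (by linarith), mul_div_cancel₀ _ hm.ne']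
      _ = (1 + theta Cm CM) ^ (N / Cm) := by rw [theta]; congr 1; ring
      _ ≤ 1 + N / Cm * theta Cm CM :=
          rpow_one_add_le_one_add_mul_self (by linarith) (by positivity)
            ((div_le_one hm).2 hNm)
  have h2 : 1 / theta Cm CM * (1 + 1 / CM) ^ n
      ≤ 1 / theta Cm CM * (1 + N / Cm * theta Cm CM) := by gcongr
  have h3 : 1 / theta Cm CM * (1 + N / Cm * theta Cm CM) = 1 / theta Cm CM + N / Cm := by
    field_simp
  linarith

lemma Ico_one_succ (T : ℕ) : Finset.Ico 1 (T + 1) = Finset.Icc 1 T := by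
  ext; simp only [Finset.mem_Icc, Finset.mem_Ico]; omega

lemma sum_fires_covered_le (hm : 0 < Cm) (hM : 0 < CM) {τ : ℕ} (hτ : 1 ≤ τ) (hτT : τ ≤ I.T) :
    ((∑ t ∈ Finset.Icc 1 I.T, ∑ i ∈ Finset.range (I.arrived t),
      if I.arrivalSlot i ≤ τ ∧ τ ≤ t then fires I (theta Cm CM) CM t i else 0 : ℕ) : ℝ)
      ≤ Cm + 1 := by
  refine le_trans (le_of_eq ?_) (sum_fires_le (I := I) hm hM hτ (show τ ≤ I.T + 1 by omega))
  have e : Finset.Ico τ (I.T + 1) = (Finset.Icc 1 I.T).filter (τ ≤ ·) := by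
    ext; simp only [Finset.mem_filter, Finset.mem_Icc, Finset.mem_Ico]; omega
  rw [e, Finset.sum_filter]
  congr 1
  refine Finset.sum_congr rfl fun t _ => ?_
  by_cases h : τ ≤ t <;> simp [h]

/-- Every effective increment is covered by an update of `D` or is one of an uncovered packet. -/
lemma sum_fires_le_uncovered_add (hm : 0 < Cm) (hM : 0 < CM) {D : Finset ℕ}
    (hD : D ⊆ I.onSlots) :
    ((∑ t ∈ Finset.Icc 1 I.T, ∑ i ∈ Finset.range (I.arrived t),
        fires I (theta Cm CM) CM t i : ℕ) : ℝ)
      ≤ ((∑ t ∈ Finset.Icc 1 I.T, ∑ i ∈ Finset.range (I.arrived t),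
        if Uncovered I D i t then fires I (theta Cm CM) CM t i else 0 : ℕ) : ℝ)
        + (Cm + 1) * D.card := by
  have h1 : ∑ t ∈ Finset.Icc 1 I.T, ∑ i ∈ Finset.range (I.arrived t),
        fires I (theta Cm CM) CM t i
      ≤ ∑ t ∈ Finset.Icc 1 I.T, ∑ i ∈ Finset.range (I.arrived t),
        (if Uncovered I D i t then fires I (theta Cm CM) CM t i else 0)
        + ∑ τ ∈ D, ∑ t ∈ Finset.Icc 1 I.T, ∑ i ∈ Finset.range (I.arrived t),
          if I.arrivalSlot i ≤ τ ∧ τ ≤ t then fires I (theta Cm CM) CM t i else 0 := by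
    rw [Finset.sum_comm (s := D), ← Finset.sum_add_distrib]
    refine Finset.sum_le_sum fun t _ => ?_
    rw [Finset.sum_comm (s := D), ← Finset.sum_add_distrib]
    refine Finset.sum_le_sum fun i _ => ?_
    by_cases hu : Uncovered I D i t
    · rw [if_pos hu]; omega
    · rw [if_neg hu, zero_add]
      simp only [Uncovered, not_forall, not_lt] at hu
      obtain ⟨τ, hτ, hle, hs⟩ := hu
      have h2 := Finset.single_le_sum (s := D)
        (f := fun τ => if I.arrivalSlot i ≤ τ ∧ τ ≤ t then fires I (theta Cm CM) CM t i else 0)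
        (fun _ _ => Nat.zero_le _) hτ
      simpa only [hs, hle, and_self, if_true] using h2
  have h2 : ((∑ τ ∈ D, ∑ t ∈ Finset.Icc 1 I.T, ∑ i ∈ Finset.range (I.arrived t),
      if I.arrivalSlot i ≤ τ ∧ τ ≤ t then fires I (theta Cm CM) CM t i else 0 : ℕ) : ℝ)
      ≤ (Cm + 1) * D.card := by
    rw [Nat.cast_sum, mul_comm, ← nsmul_eq_mul]
    refine Finset.sum_le_card_nsmul _ _ _ fun τ hτ => ?_
    have h3 := Finset.mem_Icc.1 (Finset.mem_filter.1 (hD hτ)).1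
    exact sum_fires_covered_le hm hM h3.1 h3.2
  have h3 := Nat.cast_le (α := ℝ).2 h1
  rw [Nat.cast_add] at h3
  linarith

lemma sum_unavoidable_add_le (hT : 1 ≤ I.T) {θ : ℝ} {D : Finset ℕ} (hD : D ⊆ I.onSlots) :
    ∑ t ∈ Finset.Icc 1 I.T, ∑ i ∈ Finset.range (I.arrived t), (if Unavoidable I t i then 1 else 0)
      + ∑ t ∈ Finset.Icc 1 I.T, ∑ i ∈ Finset.range (I.arrived t),
        (if Uncovered I D i t then fires I θ CM t i else 0)
      ≤ ∑ i ∈ Finset.range (I.arrived I.T), waiting I D i := by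
  rw [sum_slots_eq_sum_packets, sum_slots_eq_sum_packets, ← Finset.sum_add_distrib]
  refine Finset.sum_le_sum fun i hi => ?_
  rw [← Finset.sum_add_distrib]
  exact sum_uncovered_le_waiting hD hT (Finset.mem_range.1 hi)

/-- The bound of the algorithm by any schedule, up to the excess. -/
lemma algValue_le_add_excess (hm : 0 < Cm) (hmM : Cm ≤ CM)
    (hc : ∀ t ∈ Finset.Icc 1 I.T, Cm ≤ I.cost t ∧ I.cost t ≤ CM) (hT : 1 ≤ I.T)
    {D : Finset ℕ} (hD : D ⊆ I.onSlots) :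
    algValue I Cm CM ≤ (1 + 1 / Cm) * (1 + 1 / theta Cm CM) * I.totalCost D
      + I.maxOff * ∑ i ∈ Finset.range (I.arrived I.T),
          ∑ t ∈ Finset.Icc (I.arrivalSlot i) I.T, excess I (theta Cm CM) CM t i := by
  have hM : 0 < CM := hm.trans_le hmM
  have hθ := theta_pos hm hM
  have h1 : algValue I Cm CM ≤ ∑ i ∈ Finset.range (I.arrived I.T),
      ∑ t ∈ Finset.Icc (I.arrivalSlot i) I.T, ((if Unavoidable I t i then 1 else 0)
          + (1 + 1 / theta Cm CM) * fires I (theta Cm CM) CM t i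
          + I.maxOff * excess I (theta Cm CM) CM t i) := by
    rw [algValue_eq, sum_slots_eq_sum_packets]
    exact Finset.sum_le_sum fun i hi =>
      sum_packetCost_le hm hM (Finset.mem_range.1 hi) hT fun t ht => (hc t ht).2
  simp only [Finset.sum_add_distrib, ← Finset.mul_sum] at h1
  rw [← sum_slots_eq_sum_packets I fun t i => (if Unavoidable I t i then (1 : ℝ) else 0),
    ← sum_slots_eq_sum_packets I fun t i => (fires I (theta Cm CM) CM t i : ℝ)] at h1
  have h2 := sum_fires_le_uncovered_add (I := I) hm hM hD
  have h3 := Nat.cast_le (α := ℝ).2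
    (sum_unavoidable_add_le (I := I) (CM := CM) (θ := theta Cm CM) hT hD)
  have h4 := le_totalCost hD fun t ht => (hc t ht).1
  push_cast at h2 h3 h4
  set U := ∑ t ∈ Finset.Icc 1 I.T, ∑ i ∈ Finset.range (I.arrived t),
    (if Unavoidable I t i then (1 : ℝ) else 0)
  set F := ∑ t ∈ Finset.Icc 1 I.T, ∑ i ∈ Finset.range (I.arrived t),
    (fires I (theta Cm CM) CM t i : ℝ)
  set G := ∑ t ∈ Finset.Icc 1 I.T, ∑ i ∈ Finset.range (I.arrived t),
    (if Uncovered I D i t then (fires I (theta Cm CM) CM t i : ℝ) else 0)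
  set W := ∑ i ∈ Finset.range (I.arrived I.T), (waiting I D i : ℝ)
  have hU0 : 0 ≤ U := Finset.sum_nonneg fun _ _ => Finset.sum_nonneg fun _ _ => by
    split_ifs <;> norm_num
  have hW0 : 0 ≤ W := Finset.sum_nonneg fun _ _ => Nat.cast_nonneg _
  clear_value U F G W
  have h5 : U + F ≤ (1 + 1 / Cm) * I.totalCost D := by
    have e : (1 + 1 / Cm) * (Cm * D.card) = (Cm + 1) * D.card := by field_simp
    have h6 : (1 + 1 / Cm) * (Cm * D.card + W) ≤ (1 + 1 / Cm) * I.totalCost D := by gcongr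
    have h7 : 0 ≤ 1 / Cm * W := by positivity
    linarith
  have h8 : (1 + 1 / theta Cm CM) * (U + F)
      ≤ (1 + 1 / theta Cm CM) * ((1 + 1 / Cm) * I.totalCost D) := by gcongr
  have h9 : 0 ≤ 1 / theta Cm CM * U := by positivity
  linarith

end packing


/-! ### The excess -/

section excess

variable {I : Instance} {Cm CM : ℝ}

/-- Packet `i` survives its first window: it is still active at the start of a later one. -/
def Survives (I : Instance) (θ CM : ℝ) (i : ℕ) : Prop :=
  ∃ t, I.arrivalSlot i < I.winStart t ∧ t ≤ I.T ∧ I.arrivalSlot i < t ∧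
    sumGain I θ CM (I.arrivalSlot i) t < 1

lemma sum_excess_le_min {θ : ℝ} (hM : 0 < CM) (hθ : 0 < θ) {i : ℕ} (hT : 1 ≤ I.T)
    (hi : i < I.arrived I.T) :
    ∑ t ∈ Finset.Icc (I.arrivalSlot i) I.T, excess I θ CM t i
      ≤ min 1 (sumGain I θ CM 1 (I.T + 1)) := by
  have h1 := (I.arrivalSlot_mem hT hi).1
  have hle := I.arrivalSlot_le hT hi
  have key := sum_Icc_le_of_residual (s := I.arrivalSlot i) (T := I.T)
    (f := fun t => excess I θ CM t i) (g := fun _ => 0)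
    (ρ := fun t => min 1 (sumGain I θ CM (I.arrivalSlot i) t)) (by omega) fun t hs ht => by
      have h2 := min_le_min (le_refl (1 : ℝ))
        (sumGain_le (I := I) hM hθ (le_refl (I.arrivalSlot i)) (Nat.le_succ t))
      simp only [excess]
      split_ifs <;> simp only [Nat.succ_eq_add_one] at h2 <;> linarith
  have h2 := min_le_min (le_refl (1 : ℝ)) (sumGain_le (I := I) hM hθ h1 (le_refl (I.T + 1)))
  simp only [sumGain_self, Finset.sum_const_zero] at key
  rw [min_eq_right zero_le_one] at key
  linarith

lemma sum_excess_eq_zero {θ : ℝ} (hM : 0 < CM) (hθ : 0 < θ) {i : ℕ} (hT : 1 ≤ I.T)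
    (hi : i < I.arrived I.T) (hs : ¬ Survives I θ CM i) :
    ∑ t ∈ Finset.Icc (I.arrivalSlot i) I.T, excess I θ CM t i = 0 := by
  have h1 := (I.arrivalSlot_mem hT hi).1
  refine Finset.sum_eq_zero fun t ht => ?_
  obtain ⟨h2, h3⟩ := Finset.mem_Icc.1 ht
  rw [excess]
  split_ifs with h
  · have h4 := I.winStart_le (t := t) (by omega)
    have h5 : 1 ≤ sumGain I θ CM (I.arrivalSlot i) t := by
      by_contra hlt
      exact hs ⟨t, h, h3, by omega, not_le.1 hlt⟩
    have h6 := h5.trans (sumGain_le (I := I) hM hθ (le_refl (I.arrivalSlot i)) (Nat.le_succ t))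
    rw [min_eq_left h5, min_eq_left h6, sub_self]
  · rfl

/-- A packet that survives its first window has been active in its arrival slot if that is ON. -/
lemma one_le_fires_of_survives {θ : ℝ} (hM : 0 < CM) (hθ : 0 < θ) {i : ℕ} (hT : 1 ≤ I.T)
    (hi : i < I.arrived I.T) (hs : Survives I θ CM i) (hon : I.on (I.arrivalSlot i) = true) :
    1 ≤ fires I θ CM (I.arrivalSlot i) i := by
  obtain ⟨h1, h2⟩ := I.arrivalSlot_mem hT hi
  obtain ⟨t, _, _, hlt, ht⟩ := hs
  have h3 := level_le_sumGain (I := I) hM hθ h1 h2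
  have h4 := sumGain_le (I := I) hM hθ (le_refl (I.arrivalSlot i))
    (show I.arrivalSlot i + 1 ≤ t from hlt)
  refine one_le_bumpCount (by linarith) ?_
  have := I.winStart_le h1
  rw [Instance.reps, if_neg (by omega), if_pos hon]
  exact one_pos

/-- A packet whose arrival slot is not one of `D` waits, and each slot of `D` is the arrival slot
of at most `C_m + 1` surviving packets. -/
lemma card_survives_le (hm : 0 < Cm) (hM : 0 < CM) (hT : 1 ≤ I.T) {D : Finset ℕ}
    (hD : D ⊆ I.onSlots) [DecidablePred (Survives I (theta Cm CM) CM)] :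
    (((Finset.range (I.arrived I.T)).filter (Survives I (theta Cm CM) CM)).card : ℝ)
      ≤ ∑ i ∈ Finset.range (I.arrived I.T), (waiting I D i : ℝ) + (Cm + 1) * D.card := by
  have hθ := theta_pos hm hM
  have h1 : ((Finset.range (I.arrived I.T)).filter (Survives I (theta Cm CM) CM)).card
      ≤ ∑ i ∈ Finset.range (I.arrived I.T), waiting I D i
        + ∑ τ ∈ D, ∑ i ∈ Finset.range (I.arrived I.T), ∑ t ∈ Finset.Icc (I.arrivalSlot i) I.T,
          if I.arrivalSlot i ≤ τ ∧ τ ≤ t then fires I (theta Cm CM) CM t i else 0 := by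
    rw [Finset.sum_comm (s := D), ← Finset.sum_add_distrib, Finset.card_filter]
    refine Finset.sum_le_sum fun i hi => ?_
    split_ifs with hs
    · have hi' := Finset.mem_range.1 hi
      have hmem : I.arrivalSlot i ∈ Finset.Icc (I.arrivalSlot i) I.T :=
        Finset.mem_Icc.2 ⟨le_rfl, I.arrivalSlot_le hT hi'⟩
      by_cases hd : I.arrivalSlot i ∈ D
      · have hf := one_le_fires_of_survives hM hθ hT hi' hs (Finset.mem_filter.1 (hD hd)).2
        have h2 := Finset.single_le_sum (s := D)
          (f := fun τ => ∑ t ∈ Finset.Icc (I.arrivalSlot i) I.T,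
            if I.arrivalSlot i ≤ τ ∧ τ ≤ t then fires I (theta Cm CM) CM t i else 0)
          (fun _ _ => Nat.zero_le _) hd
        have h3 := Finset.single_le_sum (s := Finset.Icc (I.arrivalSlot i) I.T)
          (f := fun t => if I.arrivalSlot i ≤ I.arrivalSlot i ∧ I.arrivalSlot i ≤ t then
            fires I (theta Cm CM) CM t i else 0) (fun _ _ => Nat.zero_le _) hmem
        simp only [le_refl, and_self, if_true] at h3 h2
        simp only [true_and] at h2 h3
        omega
      · have hu : Uncovered I D i (I.arrivalSlot i) := fun τ hτ hle =>
          lt_of_le_of_ne hle fun h => hd (h ▸ hτ)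
        have h2 := Finset.single_le_sum (s := Finset.Icc (I.arrivalSlot i) I.T)
          (f := fun t => if Uncovered I D i t then 1 else 0) (fun _ _ => Nat.zero_le _) hmem
        simp only [if_pos hu] at h2
        rw [← waiting] at h2
        omega
    · exact Nat.zero_le _
  have h2 : ((∑ τ ∈ D, ∑ i ∈ Finset.range (I.arrived I.T),
      ∑ t ∈ Finset.Icc (I.arrivalSlot i) I.T,
        if I.arrivalSlot i ≤ τ ∧ τ ≤ t then fires I (theta Cm CM) CM t i else 0 : ℕ) : ℝ)
      ≤ (Cm + 1) * D.card := by
    rw [Nat.cast_sum, mul_comm, ← nsmul_eq_mul]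
    refine Finset.sum_le_card_nsmul _ _ _ fun τ hτ => ?_
    have h3 := Finset.mem_Icc.1 (Finset.mem_filter.1 (hD hτ)).1
    rw [← sum_slots_eq_sum_packets I fun t i =>
      if I.arrivalSlot i ≤ τ ∧ τ ≤ t then fires I (theta Cm CM) CM t i else 0]
    exact sum_fires_covered_le hm hM h3.1 h3.2
  have h3 := Nat.cast_le (α := ℝ).2 h1
  rw [Nat.cast_add, Nat.cast_sum] at h3
  linarith

lemma initialAge_le (I : Instance) : I.initialAge ≤ I.maxIncrement := le_max_left _ _

/-- A packet waits in at least `h` slots, or arrives in the last `h` slots up to an update, or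
in the last `h - 1` slots of the horizon, or is an initial packet. -/
lemma arrived_le_of_waiting (hT : 1 ≤ I.T) {D : Finset ℕ} (hD : D ⊆ I.onSlots) {h : ℕ}
    (hh : 1 ≤ h) :
    (I.arrived I.T : ℝ) ≤ (∑ i ∈ Finset.range (I.arrived I.T), (waiting I D i : ℝ)) / h
      + I.maxIncrement + (I.maxIncrement * h) * D.card + I.maxIncrement * (h - 1 : ℕ) := by
  set B : Finset ℕ := Finset.range I.initialAge ∪ D.biUnion
    (fun τ => Finset.Ico (I.arrived (τ - h)) (I.arrived τ))
    ∪ Finset.Ico (I.arrived (I.T + 1 - h)) (I.arrived I.T) with hB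
  have hcard : B.card ≤ I.maxIncrement + I.maxIncrement * h * D.card
      + I.maxIncrement * (h - 1) := by
    refine (Finset.card_union_le _ _).trans (add_le_add ((Finset.card_union_le _ _).trans
      (add_le_add ?_ ?_)) ?_)
    · rw [Finset.card_range]; exact initialAge_le I
    · rw [mul_comm]
      refine Finset.card_biUnion_le_card_mul _ _ _ fun τ hτ => ?_
      have h3 := Finset.mem_Icc.1 (Finset.mem_filter.1 (hD hτ)).1
      have h4 := I.arrived_sub_le (Nat.sub_le τ h) h3.2
      have h5 : I.maxIncrement * (τ - (τ - h)) ≤ I.maxIncrement * h :=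
        Nat.mul_le_mul_left _ (by omega)
      rw [Nat.card_Ico]; omega
    · have h4 := I.arrived_sub_le (show I.T + 1 - h ≤ I.T by omega) le_rfl
      have h5 : I.maxIncrement * (I.T - (I.T + 1 - h)) ≤ I.maxIncrement * (h - 1) :=
        Nat.mul_le_mul_left _ (by omega)
      rw [Nat.card_Ico]; omega
  have hh0 : (0 : ℝ) < h := by exact_mod_cast hh
  have hout : (((Finset.range (I.arrived I.T)) \ B).card : ℝ)
      ≤ (∑ i ∈ Finset.range (I.arrived I.T), (waiting I D i : ℝ)) / h := by
    rw [le_div_iff₀ hh0]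
    have h1 : ((Finset.range (I.arrived I.T)) \ B).card * h
        ≤ ∑ i ∈ Finset.range (I.arrived I.T), waiting I D i := by
      refine le_trans ?_ (Finset.sum_le_sum_of_subset (Finset.sdiff_subset (t := B)))
      rw [← smul_eq_mul]
      refine Finset.card_nsmul_le_sum _ _ _ fun i hi => ?_
      obtain ⟨hi1, hi2⟩ := Finset.mem_sdiff.1 hi
      have hi' := Finset.mem_range.1 hi1
      simp only [hB, Finset.mem_union, Finset.mem_biUnion, Finset.mem_range, Finset.mem_Ico,
        not_or, not_exists, not_and, not_lt] at hi2
      obtain ⟨⟨hA, hcov⟩, hend⟩ := hi2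
      have hz : I.arrived 0 = I.initialAge := by simp [Instance.arrived]
      have hnot : ∀ s, I.arrivalSlot i ≤ s ∨ I.arrived s ≤ i := by
        intro s
        rcases Nat.eq_zero_or_pos s with rfl | hs
        · right; omega
        · have := I.arrivalSlot_le_iff hT hi' hs
          omega
      have hlast : I.arrivalSlot i ≤ I.T + 1 - h := by
        rcases hnot (I.T + 1 - h) with h2 | h2
        · exact h2
        · exact absurd (hend h2) (by omega)
      have h1 := (I.arrivalSlot_mem hT hi').1
      have hsub : Finset.Icc (I.arrivalSlot i) (I.arrivalSlot i + h - 1)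
          ⊆ Finset.Icc (I.arrivalSlot i) I.T := Finset.Icc_subset_Icc le_rfl (by omega)
      calc h = ∑ t ∈ Finset.Icc (I.arrivalSlot i) (I.arrivalSlot i + h - 1), 1 := by
            rw [Finset.sum_const, Nat.card_Icc, smul_eq_mul]; omega
        _ = ∑ t ∈ Finset.Icc (I.arrivalSlot i) (I.arrivalSlot i + h - 1),
            (if Uncovered I D i t then 1 else 0) := by
            refine Finset.sum_congr rfl fun t ht => ?_
            obtain ⟨h2, h3⟩ := Finset.mem_Icc.1 ht
            rw [if_pos]
            intro τ hτ hle
            by_contra hlt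
            have h4 := Finset.mem_Icc.1 (Finset.mem_filter.1 (hD hτ)).1
            have h5 := (I.arrivalSlot_le_iff hT hi' h4.1).1 (by omega)
            rcases hnot (τ - h) with h6 | h6
            · omega
            · exact absurd (hcov τ hτ h6) (by omega)
        _ ≤ waiting I D i := Finset.sum_le_sum_of_subset hsub
    have h2 := Nat.cast_le (α := ℝ).2 h1
    rw [Nat.cast_mul, Nat.cast_sum] at h2
    exact h2
  have hsplit : I.arrived I.T ≤ ((Finset.range (I.arrived I.T)) \ B).card + B.card := by
    have := Finset.card_le_card_sdiff_add_card (s := Finset.range (I.arrived I.T)) (t := B)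
    rwa [Finset.card_range] at this
  have h2 := Nat.cast_le (α := ℝ).2 hsplit
  have h3 := Nat.cast_le (α := ℝ).2 hcard
  push_cast at h2 h3
  linarith

/-- The threshold `h ≈ C_m / K` balances the waiting costs against the arrivals in `h` slots. -/
lemma exists_threshold {a m K : ℝ} (ha : 1 ≤ a) (hK : 0 < K) (hKm : K < m)
    (hsq : a * m ≤ K ^ 2) :
    ∃ h : ℕ, 1 ≤ h ∧ m ≤ h * K ∧ a * ((h - 1 : ℕ) : ℝ) ≤ K ∧ a * h ≤ 2 * K ∧ a ≤ K := by
  have hm : 0 < m := hK.trans hKm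
  have hh1 : 1 ≤ ⌈m / K⌉₊ := Nat.ceil_pos.2 (by positivity)
  have hhle : m / K ≤ ⌈m / K⌉₊ := Nat.le_ceil _
  have hhlt := Nat.ceil_lt_add_one (show 0 ≤ m / K by positivity)
  have hpred : ((⌈m / K⌉₊ - 1 : ℕ) : ℝ) = ⌈m / K⌉₊ - 1 := by rw [Nat.cast_sub hh1]; simp
  have haK : a ≤ K := by
    by_contra hlt
    nlinarith [not_le.1 hlt]
  have hah : a * ((⌈m / K⌉₊ - 1 : ℕ) : ℝ) ≤ K := by
    calc a * ((⌈m / K⌉₊ - 1 : ℕ) : ℝ) ≤ a * (m / K) := by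
          gcongr
          rw [hpred]; linarith
      _ = a * m / K := by ring
      _ ≤ K := by rw [div_le_iff₀ hK]; nlinarith
  refine ⟨⌈m / K⌉₊, hh1, (div_le_iff₀ hK).1 hhle, hah, ?_, haK⟩
  rw [hpred] at hah
  linarith

/-- The arithmetic of the case without updates: `W` is the total waiting time, `n` the number of
packets and `X` the total of all increments. -/
lemma excess_le_of_no_update {m K W n X E : ℝ} (hm : 0 < m) (hK : 0 < K) (hW : 0 ≤ W)
    (hn0 : 0 ≤ n) (hn : n ≤ W * K / m + 2 * K) (hE : E ≤ n * min 1 X)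
    (hX : W ≤ m → X ≤ W / m) : m * E ≤ 4 * K * W := by
  have hmn : m * n ≤ W * K + 2 * K * m := by
    calc m * n ≤ m * (W * K / m + 2 * K) := by gcongr
      _ = W * K + 2 * K * m := by field_simp
  rcases le_or_gt W m with h | h
  · have h1 : E ≤ n * (W / m) :=
      hE.trans (mul_le_mul_of_nonneg_left ((min_le_right _ _).trans (hX h)) hn0)
    have h2 : m * E ≤ n * W := by
      calc m * E ≤ m * (n * (W / m)) := by gcongr
        _ = n * W := by field_simp
    have h3 : W * K / m ≤ K := by
      rw [div_le_iff₀ hm]; nlinarith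
    have h4 : n * W ≤ 3 * K * W := mul_le_mul_of_nonneg_right (by linarith) hW
    have h5 : 0 ≤ K * W := by positivity
    linarith
  · have h1 : E ≤ n := hE.trans (mul_le_of_le_one_right hn0 (min_le_left _ _))
    have h2 : m * E ≤ m * n := by gcongr
    have h3 : K * m ≤ K * W := by gcongr
    linarith [mul_nonneg hK.le hW]

/-- The excess when `C_m ≤ K`: it is at most the number of surviving packets. -/
lemma sum_excess_le_of_le (hm : 0 < Cm) (hM : 0 < CM) (hT : 1 ≤ I.T) {D : Finset ℕ}
    (hD : D ⊆ I.onSlots) {K : ℝ} (hK1 : 1 ≤ K) (hK : Cm ≤ K) :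
    Cm * ∑ i ∈ Finset.range (I.arrived I.T),
        ∑ t ∈ Finset.Icc (I.arrivalSlot i) I.T, excess I (theta Cm CM) CM t i
      ≤ 4 * K * (Cm * D.card + ∑ i ∈ Finset.range (I.arrived I.T), (waiting I D i : ℝ)) := by
  classical
  have hθ := theta_pos hm hM
  have h1 : ∑ i ∈ Finset.range (I.arrived I.T),
        ∑ t ∈ Finset.Icc (I.arrivalSlot i) I.T, excess I (theta Cm CM) CM t i
      ≤ (((Finset.range (I.arrived I.T)).filter (Survives I (theta Cm CM) CM)).card : ℝ) := by
    rw [Finset.card_filter, Nat.cast_sum]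
    refine Finset.sum_le_sum fun i hi => ?_
    have hi' := Finset.mem_range.1 hi
    by_cases hs : Survives I (theta Cm CM) CM i
    · rw [if_pos hs, Nat.cast_one]
      exact (sum_excess_le_min hM hθ hT hi').trans (min_le_left _ _)
    · rw [if_neg hs, Nat.cast_zero]
      exact (sum_excess_eq_zero hM hθ hT hi' hs).le
  have h2 := h1.trans (card_survives_le hm hM hT hD)
  have hW0 : 0 ≤ ∑ i ∈ Finset.range (I.arrived I.T), (waiting I D i : ℝ) :=
    Finset.sum_nonneg fun _ _ => Nat.cast_nonneg _
  have hd0 : (0 : ℝ) ≤ D.card := Nat.cast_nonneg _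
  generalize ∑ i ∈ Finset.range (I.arrived I.T),
    ∑ t ∈ Finset.Icc (I.arrivalSlot i) I.T, excess I (theta Cm CM) CM t i = E at h2 ⊢
  generalize ∑ i ∈ Finset.range (I.arrived I.T), (waiting I D i : ℝ) = W at h2 hW0 ⊢
  generalize (D.card : ℝ) = d at h2 hd0 ⊢
  have h3 : Cm * E ≤ Cm * (W + (Cm + 1) * d) := by gcongr
  have h4 : Cm * W ≤ K * W := by gcongr
  have h5 : (Cm + 1) * (Cm * d) ≤ (2 * K) * (Cm * d) :=
    mul_le_mul_of_nonneg_right (by linarith) (by positivity)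
  have h6 : 0 ≤ K * W := by positivity
  have h7 : 0 ≤ K * (Cm * d) := by positivity
  linarith

/-- The excess when `K < C_m`: it is at most the number of packets, and even smaller if the
schedule makes no update and the horizon is too short for `x` to become large. -/
lemma sum_excess_le_of_lt (hm : 0 < Cm) (hM : 0 < CM) (hT : 1 ≤ I.T) {D : Finset ℕ}
    (hD : D ⊆ I.onSlots) (ha : 1 ≤ I.maxIncrement) {K : ℝ} (hK0 : 0 < K) (hK : K < Cm)
    (hsq : I.maxIncrement * Cm ≤ K ^ 2) :
    Cm * ∑ i ∈ Finset.range (I.arrived I.T),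
        ∑ t ∈ Finset.Icc (I.arrivalSlot i) I.T, excess I (theta Cm CM) CM t i
      ≤ 4 * K * (Cm * D.card + ∑ i ∈ Finset.range (I.arrived I.T), (waiting I D i : ℝ)) := by
  have hθ := theta_pos hm hM
  obtain ⟨h, hh1, hmh, hah1, hah, haK⟩ :=
    exists_threshold (show (1 : ℝ) ≤ I.maxIncrement by exact_mod_cast ha) hK0 hK hsq
  have hcount := arrived_le_of_waiting hT hD hh1
  have hE : ∑ i ∈ Finset.range (I.arrived I.T),
        ∑ t ∈ Finset.Icc (I.arrivalSlot i) I.T, excess I (theta Cm CM) CM t i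
      ≤ I.arrived I.T * min 1 (sumGain I (theta Cm CM) CM 1 (I.T + 1)) := by
    rw [← nsmul_eq_mul]
    refine (Finset.sum_le_card_nsmul _ _ (min 1 (sumGain I (theta Cm CM) CM 1 (I.T + 1)))
      fun i hi => sum_excess_le_min hM hθ hT (Finset.mem_range.1 hi)).trans_eq ?_
    rw [Finset.card_range]
  have hX : D = ∅ → ∑ i ∈ Finset.range (I.arrived I.T), (waiting I D i : ℝ) ≤ Cm →
      sumGain I (theta Cm CM) CM 1 (I.T + 1)
        ≤ (∑ i ∈ Finset.range (I.arrived I.T), (waiting I D i : ℝ)) / Cm := by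
    intro hD0 hWC
    refine sumGain_le_div hm hM (show 1 ≤ I.T + 1 by omega) ?_ hWC
    have h1 := sum_unavoidable_add_le (I := I) (CM := CM) (θ := theta Cm CM) hT hD
    have h2 : ∑ s ∈ Finset.Ico 1 (I.T + 1), ∑ i ∈ Finset.range (I.arrived s),
        fires I (theta Cm CM) CM s i ≤ ∑ i ∈ Finset.range (I.arrived I.T), waiting I D i := by
      rw [Ico_one_succ]
      refine le_trans (le_of_eq ?_) ((Nat.le_add_left _ _).trans h1)
      refine Finset.sum_congr rfl fun t _ => Finset.sum_congr rfl fun i _ => ?_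
      rw [if_pos]
      intro τ hτ
      simp [hD0] at hτ
    exact_mod_cast h2
  have hd : D = ∅ ∧ (D.card : ℝ) = 0 ∨ (1 : ℝ) ≤ D.card := by
    rcases Finset.eq_empty_or_nonempty D with hD0 | hDne
    · exact Or.inl ⟨hD0, by simp [hD0]⟩
    · exact Or.inr (by exact_mod_cast hDne.card_pos)
  have hW0 : 0 ≤ ∑ i ∈ Finset.range (I.arrived I.T), (waiting I D i : ℝ) :=
    Finset.sum_nonneg fun _ _ => Nat.cast_nonneg _
  have hd0 : (0 : ℝ) ≤ D.card := Nat.cast_nonneg _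
  have hn0 : (0 : ℝ) ≤ I.arrived I.T := Nat.cast_nonneg _
  generalize ∑ i ∈ Finset.range (I.arrived I.T),
    ∑ t ∈ Finset.Icc (I.arrivalSlot i) I.T, excess I (theta Cm CM) CM t i = E at hE ⊢
  generalize ∑ i ∈ Finset.range (I.arrived I.T), (waiting I D i : ℝ) = W at hcount hX hW0 ⊢
  generalize (D.card : ℝ) = d at hcount hd0 hd ⊢
  generalize (I.arrived I.T : ℝ) = n at hcount hE hn0
  generalize sumGain I (theta Cm CM) CM 1 (I.T + 1) = X at hE hX
  generalize (I.maxIncrement : ℝ) = a at hcount hah1 hah haK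
  have hWh : W / h ≤ W * K / Cm := by
    have h0 : (0 : ℝ) < h := by exact_mod_cast hh1
    rw [div_le_div_iff₀ h0 hm, mul_assoc, mul_comm K]
    gcongr
  have hcount' : n ≤ W * K / Cm + 2 * K + 2 * K * d := by
    have : a * h * d ≤ 2 * K * d := by gcongr
    linarith
  rcases hd with ⟨hD0, hd⟩ | hd
  · rw [hd] at hcount' ⊢
    rw [mul_zero, zero_add]
    exact excess_le_of_no_update hm hK0 hW0 hn0 (by linarith) hE (hX hD0)
  · have h1 : E ≤ n := hE.trans (mul_le_of_le_one_right hn0 (min_le_left _ _))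
    have h2 : Cm * E ≤ W * K + 2 * K * Cm + 2 * K * d * Cm := by
      calc Cm * E ≤ Cm * (W * K / Cm + 2 * K + 2 * K * d) := by
            gcongr
            exact h1.trans hcount'
        _ = W * K + 2 * K * Cm + 2 * K * d * Cm := by field_simp
    have h3 : K * Cm ≤ K * Cm * d := le_mul_of_one_le_right (by positivity) hd
    have h4 : 0 ≤ K * W := by positivity
    linarith

/-- The total excess is small compared with the cost of any schedule. -/
lemma sum_excess_le (hm : 0 < Cm) (hmM : Cm ≤ CM)
    (hc : ∀ t ∈ Finset.Icc 1 I.T, Cm ≤ I.cost t) (hT : 1 ≤ I.T)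
    {D : Finset ℕ} (hD : D ⊆ I.onSlots) (ha : 1 ≤ I.maxIncrement) :
    ∑ i ∈ Finset.range (I.arrived I.T),
        ∑ t ∈ Finset.Icc (I.arrivalSlot i) I.T, excess I (theta Cm CM) CM t i
      ≤ 4 * ⌈Real.sqrt (I.maxIncrement * Cm)⌉₊ / Cm * I.totalCost D := by
  have hM : 0 < CM := hm.trans_le hmM
  have hcost := le_totalCost hD hc
  have ha1 : (1 : ℝ) ≤ I.maxIncrement := by exact_mod_cast ha
  have hpos : 0 < (I.maxIncrement : ℝ) * Cm := by positivity
  have hsq : I.maxIncrement * Cm ≤ (⌈Real.sqrt (I.maxIncrement * Cm)⌉₊ : ℝ) ^ 2 :=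
    (Real.sqrt_le_left (Nat.cast_nonneg _)).1 (Nat.le_ceil _)
  have hK1 : (1 : ℝ) ≤ (⌈Real.sqrt (I.maxIncrement * Cm)⌉₊ : ℝ) := by
    exact_mod_cast Nat.ceil_pos.2 (Real.sqrt_pos.2 hpos)
  rw [div_mul_eq_mul_div, le_div_iff₀ hm, mul_comm _ Cm]
  refine le_trans ?_ (mul_le_mul_of_nonneg_left hcost (by positivity))
  rcases le_or_gt Cm (⌈Real.sqrt (I.maxIncrement * Cm)⌉₊ : ℝ) with hcase | hcase
  · exact sum_excess_le_of_le hm hM hT hD hK1 hcase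
  · exact sum_excess_le_of_lt hm hM hT hD ha (by linarith) hcase hsq

end excess

/-! ### The upper bound -/

lemma totalCost_nonneg {I : Instance} {Cm : ℝ} (hm : 0 < Cm)
    (hc : ∀ t ∈ Finset.Icc 1 I.T, Cm ≤ I.cost t) (D : Finset ℕ) : 0 ≤ I.totalCost D :=
  Finset.sum_nonneg fun t ht => add_nonneg
    (by split_ifs; exacts [hm.le.trans (hc t ht), le_rfl]) (Nat.cast_nonneg _)

lemma opt_nonneg {I : Instance} {Cm : ℝ} (hm : 0 < Cm)
    (hc : ∀ t ∈ Finset.Icc 1 I.T, Cm ≤ I.cost t) : 0 ≤ I.opt :=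
  Finset.le_inf' _ _ fun D _ => totalCost_nonneg hm hc D

lemma add_div_le_ratioBound {Cm CM : ℝ} (hm : 0 < Cm) (hmM : Cm ≤ CM) (a L : ℕ) :
    (1 + 1 / Cm) * (1 + 1 / theta Cm CM) + L * (4 * ⌈Real.sqrt (a * Cm)⌉₊ / Cm)
      ≤ ratioBound a L Cm CM := by
  have hθ := theta_pos hm (hm.trans_le hmM)
  rw [ratioBound, ← theta]
  set K := ⌈Real.sqrt (a * Cm)⌉₊
  have hm' : 0 < 1 / Cm := by positivity
  have hθ' : 0 < 1 / theta Cm CM := by positivity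
  have h1 := one_add_mul_le_pow (a := 1 / Cm) (by linarith) (2 * K * L)
  have h2 : 0 ≤ ((2 * K * L : ℕ) : ℝ) * (1 / Cm) := by positivity
  have h3 : (1 + 1 / Cm) * (1 + 1 / theta Cm CM) * (1 + ((2 * K * L : ℕ) : ℝ) * (1 / Cm))
      ≤ (1 + 1 / Cm) * (1 + 1 / theta Cm CM) * (1 + 1 / Cm) ^ (2 * K * L) := by gcongr
  have h4 : 1 ≤ (1 + 1 / Cm) * (1 + 1 / theta Cm CM) := by nlinarith
  have h5 : (L : ℝ) * (4 * K / Cm) = 2 * (((2 * K * L : ℕ) : ℝ) * (1 / Cm)) := by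
    push_cast; ring
  have h6 : 2 * (K : ℝ) * L / Cm = ((2 * K * L : ℕ) : ℝ) * (1 / Cm) := by push_cast; ring
  rw [pow_add, pow_one, h5, h6]
  nlinarith

theorem algValue_le_ratioBound_mul_opt (I : Instance) {Cm CM : ℝ} (hm : 0 < Cm) (hmM : Cm ≤ CM)
    (hc : ∀ t ∈ Finset.Icc 1 I.T, Cm ≤ I.cost t ∧ I.cost t ≤ CM) :
    algValue I Cm CM ≤ ratioBound I.maxIncrement I.maxOff Cm CM * I.opt := by
  have hopt := opt_nonneg hm fun t ht => (hc t ht).1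
  have hratio : 0 ≤ ratioBound I.maxIncrement I.maxOff Cm CM := by
    have hθ := theta_pos hm (hm.trans_le hmM)
    refine le_trans ?_ (add_div_le_ratioBound hm hmM _ _)
    positivity
  rcases Nat.eq_zero_or_pos I.T with hT | hT
  · rw [algValue_eq, hT]
    simpa using mul_nonneg hratio hopt
  rcases Nat.eq_zero_or_pos I.maxIncrement with ha | ha
  · have hz : ∀ t ∈ Finset.Icc 1 I.T, I.arrived t = 0 := fun t ht => by
      have h1 := I.arrived_sub_le (Nat.zero_le t) (Finset.mem_Icc.1 ht).2
      have h2 : I.arrived 0 = I.initialAge := by simp [Instance.arrived]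
      have h3 := initialAge_le I
      rw [ha, zero_mul] at h1
      omega
    rw [algValue_eq, Finset.sum_eq_zero fun t ht => by rw [hz t ht, Finset.sum_range_zero]]
    exact mul_nonneg hratio hopt
  obtain ⟨D, hD, hDopt⟩ := Finset.exists_mem_eq_inf' (s := I.onSlots.powerset)
    ⟨∅, Finset.empty_mem_powerset _⟩ I.totalCost
  have hD' := Finset.mem_powerset.1 hD
  have hcost : I.opt = I.totalCost D := hDopt
  have h1 := algValue_le_add_excess hm hmM hc hT hD'
  have h2 := sum_excess_le hm hmM (fun t ht => (hc t ht).1) hT hD' ha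
  rw [← hcost] at h1 h2
  have h3 := mul_le_mul_of_nonneg_left h2 (Nat.cast_nonneg (α := ℝ) I.maxOff)
  have h4 := mul_le_mul_of_nonneg_right
    (add_div_le_ratioBound hm hmM I.maxIncrement I.maxOff) hopt
  linarith


/-! ### A worst-case instance -/

/-- One initial packet, no later arrivals, `n` ON slots, and all updates at cost `c`. -/
def singlePacket (n : ℕ) (c : ℝ) : Instance where
  T := n
  initialAge := 1
  increment := fun _ => 0
  cost := fun _ => c
  on := fun _ => true

section singlePacket

variable (n : ℕ) (c : ℝ)

lemma singlePacket_arrived (t : ℕ) : (singlePacket n c).arrived t = 1 := by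
  simp [Instance.arrived, singlePacket]

lemma singlePacket_arrivalSlot : (singlePacket n c).arrivalSlot 0 = 1 := by
  have h : 0 < (singlePacket n c).arrived 1 := by simp [singlePacket_arrived]
  exact le_antisymm ((singlePacket n c).arrivalSlot_le le_rfl h)
    ((singlePacket n c).arrivalSlot_mem le_rfl h).1

lemma singlePacket_reps {t : ℕ} (ht : 1 ≤ t) : (singlePacket n c).reps t 0 = 1 := by
  have h : (singlePacket n c).winStart t = t := by
    rcases ht.eq_or_lt with rfl | h
    · exact Instance.winStart_one _
    · obtain ⟨s, rfl⟩ := Nat.exists_eq_add_of_le' ht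
      exact Instance.winStart_succ_of_end _ (by omega) (Or.inl rfl)
  have hon : (singlePacket n c).on t = true := rfl
  simp [Instance.reps, h, hon]

lemma singlePacket_level (θ CM : ℝ) (j : ℕ) :
    level (singlePacket n c) θ CM (j + 1) 0 = (bump θ CM)^[j] 0 := by
  have hlev : ∀ t, 1 ≤ t → level (singlePacket n c) θ CM t 0
      = sumGain (singlePacket n c) θ CM 1 t := fun t ht => by
    rw [level_eq ht (by simp [singlePacket_arrived]), singlePacket_arrivalSlot]
    simp
  induction j with
  | zero => rw [hlev _ le_rfl, sumGain_self]; rfl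
  | succ j ih =>
    rw [hlev _ (by omega), sumGain_succ (by omega), ← hlev _ (by omega), singlePacket_arrived,
      Finset.sum_range_one, gain, singlePacket_reps n c (by omega), ih,
      Function.iterate_one, Function.iterate_succ_apply']
    ring

/-- If the horizon is shorter than `C_m + 1` and every update costs `C_M`, the packet stays active
throughout and each slot contributes exactly `1 + 1/θ`. -/
lemma singlePacket_algValue {Cm CM : ℝ} (hm : 0 < Cm) (hM : 0 < CM) (hn : (n : ℝ) < Cm + 1) :
    algValue (singlePacket n CM) Cm CM = n * (1 + 1 / theta Cm CM) := by
  have hθ := theta_pos hm hM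
  have hq : 1 < 1 + 1 / CM := by have : 0 < 1 / CM := by positivity
                                 linarith
  have hterm : ∀ t ∈ Finset.Icc 1 n, ∑ i ∈ Finset.range ((singlePacket n CM).arrived t),
      packetCost (singlePacket n CM) Cm CM t i = 1 + 1 / theta Cm CM := by
    intro t ht
    obtain ⟨h1, h2⟩ := Finset.mem_Icc.1 ht
    obtain ⟨j, rfl⟩ := Nat.exists_eq_add_of_le' h1
    have hlt : (bump (theta Cm CM) CM)^[j] 0 < 1 := by
      have e := iterate_bump_add_inv hM hθ 0 j
      have h3 : (1 + 1 / CM) ^ bumpCount (theta Cm CM) CM 0 j ≤ (1 + 1 / CM) ^ j :=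
        pow_le_pow_right₀ hq.le (bumpCount_le _ _)
      have h4 : (1 + 1 / CM) ^ j < (1 + 1 / CM) ^ Cm := by
        rw [← Real.rpow_natCast, Real.rpow_lt_rpow_left_iff hq]
        have : ((j + 1 : ℕ) : ℝ) ≤ n := Nat.cast_le.2 h2
        push_cast at this
        linarith
      have h5 : (1 + 1 / CM) ^ Cm = 1 + theta Cm CM := by rw [theta]; ring
      have h6 : 1 / theta Cm CM * (1 + 1 / CM) ^ bumpCount (theta Cm CM) CM 0 j
          < 1 / theta Cm CM * (1 + theta Cm CM) :=
        mul_lt_mul_of_pos_left (by linarith) (by positivity)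
      have h7 : 1 / theta Cm CM * (1 + theta Cm CM) = 1 / theta Cm CM + 1 := by field_simp
      rw [zero_add] at e
      linarith
    have hon : (singlePacket n CM).on (j + 1) = true := rfl
    have hcost : (singlePacket n CM).cost (j + 1) = CM := rfl
    rw [singlePacket_arrived, Finset.sum_range_one, packetCost, if_pos hon, if_pos hon, hcost,
      gain, singlePacket_reps n CM h1, singlePacket_level, Function.iterate_one,
      max_eq_right (by linarith), bump, if_pos hlt]
    field_simp
    ring
  rw [algValue_eq]
  refine (Finset.sum_congr rfl hterm).trans ?_
  rw [Finset.sum_const, Nat.card_Icc, Nat.add_sub_cancel, nsmul_eq_mul]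

lemma singlePacket_opt_le : (singlePacket n c).opt ≤ n := by
  refine (Finset.inf'_le _ (Finset.empty_mem_powerset _)).trans (le_of_eq ?_)
  have hage : ∀ t, (singlePacket n c).age ∅ t = 1 := by
    intro t
    induction t with
    | zero => rfl
    | succ t ih =>
      rw [Instance.age, if_neg (Finset.notMem_empty _), ih]
      rfl
  simp only [Instance.totalCost, hage]
  simp [singlePacket]

lemma singlePacket_mem_scaledInstances {a L : ℕ} (ha : 1 ≤ a) (hL : 1 ≤ L) {Em EM Cu : ℝ}
    (hE : Em ≤ EM) : singlePacket n (Cu * EM) ∈ scaledInstances a L Em EM Cu := by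
  refine ⟨?_, ?_, fun _ => EM, fun t _ => ⟨hE, le_rfl, rfl⟩⟩
  · refine max_le ha (Finset.sup_le fun t _ => Nat.zero_le _)
  · refine Finset.sup_le fun p hp => ?_
    obtain ⟨_, h1, h2⟩ := Finset.mem_filter.1 hp
    rcases h1.eq_or_lt with h | h
    · omega
    · exact absurd (h2 p.1 (Finset.mem_Ico.2 ⟨le_rfl, h⟩)) (by simp [singlePacket])

end singlePacket

/-! ### The least competitive factor -/

lemma ratioBound_mono {a a' L L' : ℕ} (ha : a ≤ a') (hL : L ≤ L') {Cm CM : ℝ} (hm : 0 < Cm)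
    (hM : 0 < CM) : ratioBound a L Cm CM ≤ ratioBound a' L' Cm CM := by
  have hθ : 0 < (1 + 1 / CM) ^ Cm - 1 := theta_pos hm hM
  have hm' : 0 < 1 / Cm := by positivity
  have hK : ⌈Real.sqrt (a * Cm)⌉₊ ≤ ⌈Real.sqrt (a' * Cm)⌉₊ := by gcongr
  have hn : 1 + 2 * ⌈Real.sqrt (a * Cm)⌉₊ * L ≤ 1 + 2 * ⌈Real.sqrt (a' * Cm)⌉₊ * L' := by gcongr
  have h1 : (1 + 1 / Cm) ^ (1 + 2 * ⌈Real.sqrt (a * Cm)⌉₊ * L)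
      ≤ (1 + 1 / Cm) ^ (1 + 2 * ⌈Real.sqrt (a' * Cm)⌉₊ * L') :=
    pow_le_pow_right₀ (by linarith) hn
  unfold ratioBound
  gcongr

section competitive

variable {a L : ℕ} {Em EM Cu : ℝ}

lemma ratioBound_mem_competitiveFactors (hEm : 0 < Em) (hE : Em ≤ EM) (hCu : 0 < Cu) :
    ratioBound a L (Cu * Em) (Cu * EM)
      ∈ competitiveFactors (scaledInstances a L Em EM Cu) (Cu * Em) (Cu * EM) := by
  rintro I ⟨ha, hL, E, hIE⟩
  have hm : 0 < Cu * Em := by positivity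
  have hmM : Cu * Em ≤ Cu * EM := by gcongr
  have hc : ∀ t ∈ Finset.Icc 1 I.T, Cu * Em ≤ I.cost t ∧ I.cost t ≤ Cu * EM := by
    intro t ht
    obtain ⟨h1, h2, h3⟩ := hIE t ht
    rw [h3]
    exact ⟨by gcongr, by gcongr⟩
  refine (algValue_le_ratioBound_mul_opt I hm hmM hc).trans ?_
  exact mul_le_mul_of_nonneg_right (ratioBound_mono ha hL hm (hm.trans_le hmM))
    (opt_nonneg hm fun t ht => (hc t ht).1)

lemma le_of_mem_competitiveFactors (ha : 1 ≤ a) (hL : 1 ≤ L) (hEm : 0 < Em) (hE : Em ≤ EM)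
    (hCu : 0 < Cu) {γ : ℝ}
    (hγ : γ ∈ competitiveFactors (scaledInstances a L Em EM Cu) (Cu * Em) (Cu * EM)) :
    1 + 1 / theta (Cu * Em) (Cu * EM) ≤ γ := by
  have hm : 0 < Cu * Em := by positivity
  have hM : 0 < Cu * EM := mul_pos hCu (hEm.trans_le hE)
  have hθ := theta_pos hm hM
  set n := ⌈Cu * Em⌉₊ with hn
  have hn0 : (0 : ℝ) < n := by exact_mod_cast Nat.ceil_pos.2 hm
  have h1 := hγ _ (singlePacket_mem_scaledInstances n (Cu := Cu) ha hL hE)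
  rw [singlePacket_algValue n hm hM (Nat.ceil_lt_add_one hm.le)] at h1
  have h2 := singlePacket_opt_le n (Cu * EM)
  have h3 : 0 ≤ (singlePacket n (Cu * EM)).opt := opt_nonneg hM fun _ _ => le_rfl
  have h4 : 0 < 1 + 1 / theta (Cu * Em) (Cu * EM) := by positivity
  have h5 : 0 < γ := by
    by_contra hneg
    have := mul_nonpos_of_nonpos_of_nonneg (not_lt.1 hneg) h3
    have := mul_pos hn0 h4
    linarith
  have h6 : n * (1 + 1 / theta (Cu * Em) (Cu * EM)) ≤ n * γ := by
    rw [mul_comm (n : ℝ) γ]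
    exact h1.trans (mul_le_mul_of_nonneg_left h2 h5.le)
  exact le_of_mul_le_mul_left h6 hn0

lemma isLeast_sInf_competitiveFactors (ha : 1 ≤ a) (hL : 1 ≤ L) (hEm : 0 < Em) (hE : Em ≤ EM)
    (hCu : 0 < Cu) :
    IsLeast (competitiveFactors (scaledInstances a L Em EM Cu) (Cu * Em) (Cu * EM))
      (sInf (competitiveFactors (scaledInstances a L Em EM Cu) (Cu * Em) (Cu * EM))) := by
  refine IsClosed.isLeast_csInf ?_ ⟨_, ratioBound_mem_competitiveFactors hEm hE hCu⟩
    ⟨_, fun γ hγ => le_of_mem_competitiveFactors ha hL hEm hE hCu hγ⟩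
  have e : competitiveFactors (scaledInstances a L Em EM Cu) (Cu * Em) (Cu * EM)
      = ⋂ I ∈ scaledInstances a L Em EM Cu,
        {γ | algValue I (Cu * Em) (Cu * EM) ≤ γ * I.opt} := by
    ext γ; simp [competitiveFactors]
  rw [e]
  exact isClosed_biInter fun I _ => isClosed_le continuous_const (continuous_mul_const I.opt)

end competitive

/-! ### The limit of large update costs -/

open Filter Topology

lemma tendsto_one_add_inv_theta {Em EM : ℝ} (hEm : 0 < Em) (hE : Em ≤ EM) :
    Tendsto (fun Cu : ℝ => 1 + 1 / ((1 + 1 / (Cu * EM)) ^ (Cu * Em) - 1)) atTop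
      (𝓝 (Real.exp (Em / EM) / (Real.exp (Em / EM) - 1))) := by
  have hEM : 0 < EM := hEm.trans_le hE
  have hexp : 1 < Real.exp (Em / EM) := Real.one_lt_exp_iff.2 (by positivity)
  have h1 : Tendsto (fun Cu : ℝ => (1 + 1 / (Cu * EM)) ^ (Cu * Em)) atTop
      (𝓝 (Real.exp (Em / EM))) := by
    have h2 := (Real.tendsto_one_add_div_rpow_exp (1 / EM)).rpow_const (p := Em)
      (Or.inr hEm.le)
    rw [← Real.exp_mul, one_div_mul_eq_div] at h2
    refine h2.congr' ?_
    filter_upwards [eventually_gt_atTop 0] with Cu hCu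
    have hb : 0 ≤ 1 + 1 / EM / Cu := by positivity
    rw [← Real.rpow_mul hb, div_div, mul_comm EM Cu]
  have h3 : Real.exp (Em / EM) / (Real.exp (Em / EM) - 1)
      = 1 + 1 / (Real.exp (Em / EM) - 1) := by
    have : Real.exp (Em / EM) - 1 ≠ 0 := by linarith
    field_simp
    ring
  rw [h3]
  exact tendsto_const_nhds.add (tendsto_const_nhds.div (h1.sub tendsto_const_nhds) (by linarith))

lemma tendsto_ceil_sqrt_div (a : ℕ) :
    Tendsto (fun m : ℝ => (⌈Real.sqrt (a * m)⌉₊ : ℝ) / m) atTop (𝓝 0) := by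
  have h1 : Tendsto (fun m : ℝ => Real.sqrt a / Real.sqrt m + 1 / m) atTop (𝓝 0) := by
    have := (tendsto_const_nhds (x := Real.sqrt a)).div_atTop Real.tendsto_sqrt_atTop
    simpa using this.add ((tendsto_const_nhds (x := (1 : ℝ))).div_atTop tendsto_id)
  refine tendsto_of_tendsto_of_tendsto_of_le_of_le' tendsto_const_nhds h1 ?_ ?_
  · filter_upwards [eventually_gt_atTop 0] with m hm
    positivity
  · filter_upwards [eventually_gt_atTop 0] with m hm
    have h2 := (Nat.ceil_lt_add_one (Real.sqrt_nonneg (a * m))).le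
    have h3 : Real.sqrt (a * m) / m = Real.sqrt a / Real.sqrt m := by
      rw [Real.sqrt_mul (Nat.cast_nonneg a), div_eq_div_iff hm.ne' (Real.sqrt_pos.2 hm).ne',
        mul_assoc, Real.mul_self_sqrt hm.le]
    rw [← h3, ← add_div]
    gcongr

lemma tendsto_one_add_inv_pow (a L : ℕ) :
    Tendsto (fun m : ℝ => (1 + 1 / m) ^ (1 + 2 * ⌈Real.sqrt (a * m)⌉₊ * L)) atTop (𝓝 1) := by
  have h1 : Tendsto (fun m : ℝ => Real.exp (1 / m + 2 * L * (⌈Real.sqrt (a * m)⌉₊ / m))) atTop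
      (𝓝 1) := by
    have h2 := ((tendsto_const_nhds (x := (1 : ℝ))).div_atTop tendsto_id).add
      ((tendsto_ceil_sqrt_div a).const_mul (2 * L : ℝ))
    have h3 := (Real.continuous_exp.tendsto _).comp h2
    rw [mul_zero, add_zero, Real.exp_zero] at h3
    exact h3
  refine tendsto_of_tendsto_of_tendsto_of_le_of_le' tendsto_const_nhds h1 ?_ ?_
  · filter_upwards [eventually_gt_atTop 0] with m hm
    have : 0 < 1 / m := by positivity
    exact one_le_pow₀ (by linarith)
  · filter_upwards [eventually_gt_atTop 0] with m hm
    have h2 : 0 < 1 / m := by positivity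
    have h3 : 1 + 1 / m ≤ Real.exp (1 / m) := by linarith [Real.add_one_le_exp (1 / m)]
    refine (pow_le_pow_left₀ (by linarith) h3 _).trans (le_of_eq ?_)
    rw [← Real.exp_nat_mul]
    congr 1
    push_cast
    ring

lemma tendsto_ratioBound (a L : ℕ) {Em EM : ℝ} (hEm : 0 < Em) (hE : Em ≤ EM) :
    Tendsto (fun Cu : ℝ => ratioBound a L (Cu * Em) (Cu * EM)) atTop
      (𝓝 (Real.exp (Em / EM) / (Real.exp (Em / EM) - 1))) := by
  have hlin : Tendsto (fun Cu : ℝ => Cu * Em) atTop atTop := tendsto_id.atTop_mul_const hEm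
  have h1 := ((tendsto_one_add_inv_pow a L).comp hlin).mul (tendsto_one_add_inv_theta hEm hE)
  have h2 := ((tendsto_ceil_sqrt_div a).comp hlin).const_mul (2 * L : ℝ)
  have h3 := h1.add h2
  rw [one_mul, mul_zero, add_zero] at h3
  refine h3.congr fun Cu => ?_
  simp only [Function.comp, ratioBound]
  ring

end AgeUpdate

theorem mainTheorem7 :
    (∀ (I : AgeUpdate.Instance) (Cm CM : ℝ), 0 < Cm → Cm ≤ CM →
      (∀ t ∈ Finset.Icc 1 I.T, Cm ≤ I.cost t ∧ I.cost t ≤ CM) →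
      AgeUpdate.algValue I Cm CM
        ≤ AgeUpdate.ratioBound I.maxIncrement I.maxOff Cm CM * I.opt) ∧
    (∀ (Em EM R : ℝ), 0 < Em → Em ≤ EM → R = EM / Em → ∀ a L : ℕ,
      Filter.Tendsto (fun Cu : ℝ => AgeUpdate.ratioBound a L (Cu * Em) (Cu * EM))
        Filter.atTop (nhds (Real.exp (1 / R) / (Real.exp (1 / R) - 1))) ∧
      (1 ≤ a → 1 ≤ L → ∃ ρ : ℝ → ℝ,
        (∀ Cu : ℝ, 0 < Cu → IsLeast
          (AgeUpdate.competitiveFactors (AgeUpdate.scaledInstances a L Em EM Cu)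
            (Cu * Em) (Cu * EM)) (ρ Cu)) ∧
        Filter.Tendsto ρ Filter.atTop
          (nhds (Real.exp (1 / R) / (Real.exp (1 / R) - 1))))) := by
  refine ⟨fun I Cm CM hm hmM hc => AgeUpdate.algValue_le_ratioBound_mul_opt I hm hmM hc, ?_⟩
  intro Em EM R hEm hE hR a L
  rw [hR, one_div_div]
  have hbound := AgeUpdate.tendsto_ratioBound a L hEm hE
  refine ⟨hbound, fun ha hL => ⟨_, fun Cu hCu =>
    AgeUpdate.isLeast_sInf_competitiveFactors ha hL hEm hE hCu, ?_⟩⟩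
  refine tendsto_of_tendsto_of_tendsto_of_le_of_le'
    (AgeUpdate.tendsto_one_add_inv_theta hEm hE) hbound ?_ ?_
  · filter_upwards [Filter.eventually_gt_atTop 0] with Cu hCu
    exact AgeUpdate.le_of_mem_competitiveFactors ha hL hEm hE hCu
      (AgeUpdate.isLeast_sInf_competitiveFactors ha hL hEm hE hCu).1
  · filter_upwards [Filter.eventually_gt_atTop 0] with Cu hCu
    exact (AgeUpdate.isLeast_sInf_competitiveFactors ha hL hEm hE hCu).2
      (AgeUpdate.ratioBound_mem_competitiveFactors hEm hE hCu)
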